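/- Let $F:\mathbb{R}^2\to\mathbb{R}^2$ be an excellent map, i.e. a $C^\infty$ map such that near each critical point (point where $\det DF=0$), after smooth changes of variables in the domain and in the target that send the critical point and its image to the origin, $F$ becomes either $(x,y)\mapsto(x,y^2)$ (a fold) or $(x,y)\mapsto(x,y^3-xy)$ (a cusp). Let $C$ be the set of critical points of $F$. For a regular closed curve $c:\mathbb{S}^1\to\mathbb{R}^2$ (a $C^1$ map whose velocity $(c\circ e)'$ never vanishes, where $e(t)=(\cos t,\sin t)$), the rotation number $r(c)$ is the winding number around $0$ of the velocity $(c\circ e)'$ on $[0,2\pi]$, i.e. the total variation of a continuous argument of the velocity divided by $2\pi$. Let $n\ge 0$ and let $\gamma_0,\gamma_1,\dots,\gamma_n$ be smooth (that is, regularly parametrized $C^1$) simple closed curves in the plane, all positively oriented (each has winding number $1$ around the points it encloses). Suppose that the closed disks bounded by $\gamma_1,\dots,\gamma_n$ are pairwise disjoint and contained in the open region enclosed by $\gamma_0$, and let $\Delta_n$ be the closed disk with $n$ holes obtained from the closed disk bounded by $\gamma_0$ by removing the open regions enclosed by $\gamma_1,\dots,\gamma_n$. Suppose that $\Delta_n\cap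 C=\emptyset$. Then each $F\circ\gamma_i$ $(0\le i\le n)$ is a regular closed curve, the sign $s$ of $\det DF(p)$ is the same for all $p\in\Delta_n$, and $$r(F(\gamma_0)) = \sum_{i=1}^{n} r(F(\gamma_i)) - s\,(n-1).$$ -/

import Mathlib

open scoped ContDiff Topology Real

noncomputable section

namespace PlaneMap

/-- The Euclidean plane. -/
abbrev Plane : Type := EuclideanSpace ℝ (Fin 2)

/-! ### Excellent maps of the plane -/

/-- The determinant of the Jacobian of `F` at `p`. -/
def jac (F : Plane → Plane) (p : Plane) : ℝ := (fderiv ℝ F p).det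

/-- The critical set of `F`: the points at which the Jacobian matrix is not invertible. -/
def criticalSet (F : Plane → Plane) : Set Plane := {p | jac F p = 0}

/-- A smooth diffeomorphism between two open subsets of the plane. -/
def IsSmoothChange (Φ : OpenPartialHomeomorph Plane Plane) : Prop :=
  ContDiffOn ℝ ∞ Φ Φ.source ∧ ContDiffOn ℝ ∞ Φ.symm Φ.target

/-- After smooth changes of variables near `p` and near `F p`, which bring both points to the
origin, `F` becomes `N` near the origin. -/
def HasNormalForm (N F : Plane → Plane) (p : Plane) : Prop :=
  ∃ Φ Ψ : OpenPartialHomeomorph Plane Plane, IsSmoothChange Φ ∧ IsSmoothChange Ψ ∧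
    p ∈ Ψ.source ∧ Ψ p = 0 ∧ (0 : Plane) ∈ Φ.source ∧ ∀ᶠ q in 𝓝 p, F q = Φ (N (Ψ q))

/-- The normal form `(x, y) ↦ (x, y ^ 2)` of a fold. -/
def foldForm (v : Plane) : Plane := !₂[v 0, v 1 ^ 2]

/-- The normal form `(x, y) ↦ (x, y ^ 3 - x y)` of a cusp. -/
def cuspForm (v : Plane) : Plane := !₂[v 0, v 1 ^ 3 - v 0 * v 1]

/-- An excellent smooth map: all its critical points are folds or cusps. -/
structure IsExcellent (F : Plane → Plane) : Prop where
  smooth : ContDiff ℝ ∞ F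
  fold_or_cusp : ∀ p ∈ criticalSet F, HasNormalForm foldForm F p ∨ HasNormalForm cuspForm F p

/-! ### Winding numbers and rotation numbers -/

/-- `θ` is a continuous argument function on `[a, b]` for the path `φ` as seen from `p`. -/
def IsArgument (φ : ℝ → Plane) (p : Plane) (a b : ℝ) (θ : ℝ → ℝ) : Prop :=
  ContinuousOn θ (Set.Icc a b) ∧
    ∀ t ∈ Set.Icc a b, φ t - p = ‖φ t - p‖ • (!₂[Real.cos (θ t), Real.sin (θ t)] : Plane)

open Classical in
/-- The angle swept on `[a, b]` by the path `φ` as seen from `p` (meaningful if `φ` is continuous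
on `[a, b]` and avoids `p` there; see `angleSwept_eq`). -/
def angleSwept (φ : ℝ → Plane) (p : Plane) (a b : ℝ) : ℝ :=
  if h : ∃ θ : ℝ → ℝ, IsArgument φ p a b θ then h.choose b - h.choose a else 0

/-- The angle swept does not depend on the choice of the argument function. -/
theorem angleSwept_eq {φ : ℝ → Plane} {p : Plane} {a b : ℝ} (hab : a ≤ b)
    (hp : ∀ t ∈ Set.Icc a b, φ t ≠ p) {θ : ℝ → ℝ} (hθ : IsArgument φ p a b θ) :
    angleSwept φ p a b = θ b - θ a := by
  have hex : ∃ θ : ℝ → ℝ, IsArgument φ p a b θ := ⟨θ, hθ⟩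
  rw [angleSwept, dif_pos hex]
  have hη := hex.choose_spec
  generalize hex.choose = η at hη
  have hg : ContinuousOn (fun t => η t - θ t) (Set.Icc a b) := hη.1.sub hθ.1
  have hmem : Set.MapsTo (fun t => η t - θ t) (Set.Icc a b)
      (Set.range fun k : ℤ => (k : ℝ) * (2 * π)) := by
    intro t ht
    have hn : ‖φ t - p‖ ≠ 0 := norm_ne_zero_iff.2 (sub_ne_zero.2 (hp t ht))
    have h := (hη.2 t ht).symm.trans (hθ.2 t ht)
    have h' := smul_right_injective Plane hn h
    have hc : Real.cos (η t) = Real.cos (θ t) := by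
      simpa using congrArg (fun v : Plane => v 0) h'
    have hs : Real.sin (η t) = Real.sin (θ t) := by
      simpa using congrArg (fun v : Plane => v 1) h'
    have hang : (η t : Real.Angle) = (θ t : Real.Angle) := Real.Angle.cos_sin_inj hc hs
    obtain ⟨k, hk⟩ := Real.Angle.angle_eq_iff_two_pi_dvd_sub.1 hang
    exact ⟨k, by simp only [hk]; ring⟩
  have htd : IsTotallyDisconnected (Set.range fun k : ℤ => (k : ℝ) * (2 * π)) :=
    (Set.countable_range _).isTotallyDisconnected
  have hconn := (isPreconnected_Icc (a := a) (b := b)).image _ hg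
  have hsub := htd _ hmem.image_subset hconn
  have := hsub (Set.mem_image_of_mem _ (Set.left_mem_Icc.2 hab))
    (Set.mem_image_of_mem _ (Set.right_mem_Icc.2 hab))
  linarith

/-- The winding number around `p` of the closed curve parametrized by `φ` on `[0, 2π]`. -/
def windingNumber (φ : ℝ → Plane) (p : Plane) : ℝ := angleSwept φ p 0 (2 * π) / (2 * π)

/-- The parametrization `c ∘ e` of a closed curve `c`, where `e t = (cos t, sin t)`. -/
def unroll (c : Circle → Plane) (t : ℝ) : Plane := c (Circle.exp t)

/-- A parametrized regular closed curve: a `C^1` map from the circle to the plane whose velocity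
never vanishes. -/
structure IsRegularClosedCurve (c : Circle → Plane) : Prop where
  contDiff : ContDiff ℝ 1 (unroll c)
  deriv_ne_zero : ∀ t, deriv (unroll c) t ≠ 0

/-- The rotation number of a regular closed curve: the winding number of its velocity around the
origin. -/
def rotationNumber (c : Circle → Plane) : ℝ := windingNumber (deriv (unroll c)) 0

/-! ### Disks with holes -/

/-- The open region enclosed by a closed curve: the union of the bounded components of its
complement (for a simple closed curve there is exactly one). -/
def inside (c : Circle → Plane) : Set Plane :=
  {p | p ∉ Set.range c ∧ Bornology.IsBounded (connectedComponentIn (Set.range c)ᶜ p)}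

/-- The closed region bounded by a closed curve: for a simple closed curve, the closed topological
disk of which the curve is the boundary. -/
def closedRegion (c : Circle → Plane) : Set Plane := inside c ∪ Set.range c

/-- A smooth simple closed curve, regularly parametrized in the positive (counterclockwise)
direction: it winds once around each point that it encloses. -/
structure IsPositiveSimpleClosedCurve (c : Circle → Plane) : Prop where
  regular : IsRegularClosedCurve c
  injective : Function.Injective c
  positive : ∀ p ∈ inside c, windingNumber (unroll c) p = 1

/-- `Δ` is the closed disk with `n` holes with outer boundary curve `γ₀` and inner boundary curves
`γ 0, …, γ (n - 1)`: the disk bounded by `γ₀` with the interiors removed of `n` pairwise disjoint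
closed disks that lie in its interior. -/
structure IsDiskWithHoles (Δ : Set Plane) (γ₀ : Circle → Plane) {n : ℕ}
    (γ : Fin n → Circle → Plane) : Prop where
  outer : IsPositiveSimpleClosedCurve γ₀
  inner : ∀ i, IsPositiveSimpleClosedCurve (γ i)
  subset : ∀ i, closedRegion (γ i) ⊆ inside γ₀
  disjoint : ∀ i j, i ≠ j → Disjoint (closedRegion (γ i)) (closedRegion (γ j))
  eq_diff : Δ = closedRegion γ₀ \ ⋃ i, inside (γ i)

end PlaneMap

end

/-! Identify the plane with `ℂ`. Let `a = DF·e₁` and `b = DF·e₂`, viewed as complex-valued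
functions. On `Δ` the Jacobian does not vanish, so `a` has no zeros there and `Im (b/a)` has the
sign `s` of the Jacobian. The velocity of `F ∘ c` is `a v₀ + b v₁` with `v` the velocity of `c`.
Moving `b/a` to `s·i` inside its half-plane turns it into `a (v₀ + s i v₁)`, that is, `a v` or `a`
times the conjugate of `v`, with the same winding number. For a positive simple closed curve `v`
winds once (Umlaufsatz, `IsSimpleLoop.hasWinding_deriv`), so `r(F ∘ c) = k + s`, where `k` is the
winding number of `a` along `c` (`rotationNumber_comp`).

It remains to see that `k₀ = ∑ kᵢ` (`IsDiskWithHoles.winding_comp_eq_sum`); then `r(F ∘ γ₀) = ∑ (r(F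
∘ γᵢ) - s) + s`. The form `d arg a` is closed near `Δ`, and the cycle `γ₀ - ∑ γᵢ` winds around no
point outside `Δ`. Stokes' theorem is replaced by the Cauchy–Pompeiu formula: for compactly
supported `p`, integrating it along a curve expresses `∮ p dz` as the plane integral of `dbar p`
against the winding number of the curve (`sum_winding_comp_eq_zero`).

The Jordan curve theorem is never invoked. Points outside `closedRegion` have winding number `0`
and, by positivity, points of `inside` have winding number `1`; looking next to a lowest point of
the curve shows that `inside` is nonempty. Connectedness of `Δ`, which makes `s` constant, is itself
deduced from `winding_comp_eq_sum`. -/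

open Complex Set Filter MeasureTheory

namespace PlaneMap

/-! ### Winding numbers of closed curves in the complex plane -/

/-- A continuous map without zeros from a simply connected space to `ℂ` has a continuous
logarithm. -/
theorem exists_continuous_log {X : Type*} [TopologicalSpace X] [SimplyConnectedSpace X]
    [LocallyPathConnectedSpace X] {f : X → ℂ} (hf : Continuous f) (h0 : ∀ x, f x ≠ 0) :
    ∃ L : X → ℂ, Continuous L ∧ ∀ x, exp (L x) = f x := by
  obtain ⟨x₀⟩ : Nonempty X := inferInstance
  rcases isCoveringMapOn_exp.existsUnique_continuousMap_lifts ⟨f, hf⟩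
    (exp_log (h0 x₀)) (fun x ↦ h0 x) with ⟨L, ⟨-, hL⟩, -⟩
  exact ⟨L, L.continuous, fun x ↦ congrFun hL x⟩

/-- Two continuous logarithms of the same function differ by a constant. -/
theorem log_sub_log_eq {s : Set ℝ} (hs : IsPreconnected s) {L L' : ℝ → ℂ}
    (hL : ContinuousOn L s) (hL' : ContinuousOn L' s)
    (h : ∀ t ∈ s, exp (L t) = exp (L' t)) {a b : ℝ} (ha : a ∈ s) (hb : b ∈ s) :
    L b - L a = L' b - L' a := by
  have hmem : MapsTo (fun t => L t - L' t) s (range fun k : ℤ => (k : ℂ) * (2 * π * I)) := by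
    intro t ht
    obtain ⟨k, hk⟩ := exp_eq_exp_iff_exists_int.1 (h t ht)
    exact ⟨k, by simp only [hk]; ring⟩
  have htd : IsTotallyDisconnected (range fun k : ℤ => (k : ℂ) * (2 * π * I)) :=
    (countable_range _).isTotallyDisconnected
  have := htd _ hmem.image_subset (hs.image _ (hL.sub hL')) (mem_image_of_mem _ ha)
    (mem_image_of_mem _ hb)
  linear_combination -this

/-- The closed curve `ψ : ℝ → ℂ` of period `2π` avoids the origin and winds `k` times around it. -/
def HasWinding (ψ : ℝ → ℂ) (k : ℤ) : Prop :=
  ∃ M : ℝ → ℂ, Continuous M ∧ Function.Periodic M (2 * π) ∧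
    ∀ t, ψ t = exp (k * t * I + M t)

theorem exists_hasWinding {ψ : ℝ → ℂ} (hc : Continuous ψ) (hp : Function.Periodic ψ (2 * π))
    (h0 : ∀ t, ψ t ≠ 0) : ∃ k, HasWinding ψ k := by
  obtain ⟨L, hL, hexp⟩ := exists_continuous_log hc h0
  obtain ⟨k, hk⟩ : ∃ k : ℤ, L (2 * π) = L 0 + k * (2 * π * I) :=
    exp_eq_exp_iff_exists_int.1 (by rw [hexp, hexp]; simpa using hp 0)
  refine ⟨k, fun t => L t - k * t * I, by fun_prop, fun t => ?_, fun t => ?_⟩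
  -- `L` and its translate by a period are logarithms of the same function, so the increment over a
  -- period is the same from every starting point.
  · have := log_sub_log_eq isPreconnected_univ (L := fun t => L (t + 2 * π)) (L' := L)
      (by fun_prop) (by fun_prop) (fun t _ => by rw [hexp, hexp, hp]) (mem_univ 0) (mem_univ t)
    simp only [zero_add] at this
    push_cast
    linear_combination this + hk
  · rw [← hexp]; congr 1; ring

namespace HasWinding

variable {ψ χ : ℝ → ℂ} {k l : ℤ}

theorem continuous (h : HasWinding ψ k) : Continuous ψ := by
  obtain ⟨M, hM, -, h⟩ := h
  rw [funext h]; fun_prop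

theorem periodic (h : HasWinding ψ k) : Function.Periodic ψ (2 * π) := by
  obtain ⟨M, -, hp, h⟩ := h
  intro t
  rw [h, h, hp, exp_eq_exp_iff_exists_int]
  exact ⟨k, by push_cast; ring⟩

theorem ne_zero (h : HasWinding ψ k) (t : ℝ) : ψ t ≠ 0 := by
  obtain ⟨M, -, -, h⟩ := h
  rw [h]; exact exp_ne_zero _

theorem mul (h : HasWinding ψ k) (h' : HasWinding χ l) :
    HasWinding (fun t => ψ t * χ t) (k + l) := by
  obtain ⟨M, hM, hp, h⟩ := h
  obtain ⟨N, hN, hq, h'⟩ := h'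
  refine ⟨fun t => M t + N t, by fun_prop, fun t => by simp only [hp t, hq t], fun t => ?_⟩
  simp only; rw [h, h', ← exp_add]; congr 1; push_cast; ring

theorem conj (h : HasWinding ψ k) : HasWinding (fun t => starRingEnd ℂ (ψ t)) (-k) := by
  obtain ⟨M, hM, hp, h⟩ := h
  refine ⟨fun t => starRingEnd ℂ (M t), by fun_prop, fun t => by simp only [hp t], fun t => ?_⟩
  simp only; rw [h, ← exp_conj]; congr 1; simp

theorem comp_add (h : HasWinding ψ k) (a : ℝ) : HasWinding (fun t => ψ (t + a)) k := by
  obtain ⟨M, hM, hp, h⟩ := h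
  refine ⟨fun t => k * a * I + M (t + a), by fun_prop, fun t => ?_, fun t => ?_⟩
  · simp only; rw [add_right_comm, hp]
  · simp only; rw [h]; congr 1; push_cast; ring

theorem of_slitPlane (hc : Continuous ψ) (hp : Function.Periodic ψ (2 * π))
    (h : ∀ t, ψ t ∈ slitPlane) : HasWinding ψ 0 :=
  ⟨fun t => log (ψ t), hc.clog h, fun t => by simp only [hp t],
    fun t => by simp [exp_log (slitPlane_ne_zero (h t))]⟩

theorem const {z : ℂ} (hz : z ≠ 0) : HasWinding (fun _ => z) 0 :=
  ⟨fun _ => log z, continuous_const, fun _ => rfl, fun _ => by simp [exp_log hz]⟩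

theorem const_mul (h : HasWinding ψ k) {z : ℂ} (hz : z ≠ 0) :
    HasWinding (fun t => z * ψ t) k := by
  simpa using (const hz).mul h

/-- A quotient that is never zero or a negative real has a continuous periodic logarithm, the
principal one. This Rouché-type criterion is how winding numbers are compared below, in place of
homotopies. -/
theorem of_div (h : HasWinding ψ k) (hc : Continuous χ) (hp : Function.Periodic χ (2 * π))
    (hd : ∀ t, χ t / ψ t ∈ slitPlane) : HasWinding χ k := by
  have := h.mul (of_slitPlane (ψ := fun t => χ t / ψ t) (hc.div h.continuous h.ne_zero)
    (fun t => by simp only [hp t, h.periodic t]) hd)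
  simpa [mul_div_cancel₀ _ (h.ne_zero _)] using this

theorem log_sub (h : HasWinding ψ k) {L : ℝ → ℂ} (hL : ContinuousOn L (Icc 0 (2 * π)))
    (he : ∀ t ∈ Icc 0 (2 * π), exp (L t) = ψ t) : L (2 * π) - L 0 = k * (2 * π * I) := by
  obtain ⟨M, hM, hp, h⟩ := h
  have := log_sub_log_eq isPreconnected_Icc hL (L' := fun t => k * t * I + M t) (by fun_prop)
    (fun t ht => by rw [he t ht, h]) (left_mem_Icc.2 Real.two_pi_pos.le)
    (right_mem_Icc.2 Real.two_pi_pos.le)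
  rw [this]
  have := hp 0
  rw [zero_add] at this
  simp [this]; ring

theorem unique (h : HasWinding ψ k) (h' : HasWinding ψ l) : k = l := by
  have h1 := h'
  obtain ⟨M, hM, hp, h'⟩ := h'
  have hs : Continuous fun t : ℝ => (l * t * I + M t : ℂ) := by fun_prop
  have := (h.log_sub hs.continuousOn fun t _ => (h' t).symm).symm.trans
    (h1.log_sub hs.continuousOn fun t _ => (h' t).symm)
  have := mul_right_cancel₀ two_pi_I_ne_zero this
  exact_mod_cast this

/-- The winding number as the integral of the logarithmic derivative. -/
theorem integral_eq (h : HasWinding ψ k) {ψ' : ℝ → ℂ} (hd : ∀ t, HasDerivAt ψ (ψ' t) t)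
    (hc : Continuous ψ') : ∫ t in (0 : ℝ)..2 * π, ψ' t / ψ t = k * (2 * π * I) := by
  have hq : Continuous fun t => ψ' t / ψ t := hc.div h.continuous h.ne_zero
  set L : ℝ → ℂ := fun t => log (ψ 0) + ∫ x in (0 : ℝ)..t, ψ' x / ψ x with hLdef
  have hL : ∀ t, HasDerivAt L (ψ' t / ψ t) t := fun t =>
    (intervalIntegral.integral_hasDerivAt_right (hq.intervalIntegrable _ _)
      (hq.stronglyMeasurableAtFilter _ _) hq.continuousAt).const_add _
  have hconst : ∀ t, exp (-L t) * ψ t = exp (-L 0) * ψ 0 := fun t => by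
    refine is_const_of_deriv_eq_zero (f := fun t => exp (-L t) * ψ t) (fun t => ?_) (fun t => ?_) _ _
    · exact ((hL t).neg.cexp.mul (hd t)).differentiableAt
    · have := ((hL t).neg.cexp.mul (hd t)).deriv
      refine this.trans ?_
      have := h.ne_zero t
      field_simp
      ring
  have := h.log_sub (L := L) (fun t _ => (hL t).continuousAt.continuousWithinAt) fun t _ => by
    have h1 := hconst t
    have h2 : exp (-L 0) * ψ 0 = 1 := by
      simp [hLdef, exp_neg, exp_log (h.ne_zero 0), h.ne_zero 0]
    rw [h2, exp_neg] at h1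
    field_simp at h1
    exact h1.symm
  rw [← this]; simp [hLdef]

end HasWinding

/-- The identification of the Euclidean plane with the complex plane. -/
noncomputable def toC : Plane ≃ₗᵢ[ℝ] ℂ := Complex.orthonormalBasisOneI.repr.symm

theorem toC_apply (p : Plane) : toC p = p 0 + p 1 * I := by
  simp [toC, Complex.orthonormalBasisOneI]

@[simp] theorem toC_re (p : Plane) : (toC p).re = p 0 := by simp [toC_apply]

@[simp] theorem toC_im (p : Plane) : (toC p).im = p 1 := by simp [toC_apply]

theorem HasWinding.windingNumber_eq {φ : ℝ → Plane} {p : Plane} {k : ℤ}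
    (h : HasWinding (fun t => toC (φ t) - toC p) k) : windingNumber φ p = k := by
  have hne : ∀ t, φ t ≠ p := fun t ht => h.ne_zero t (by simp [ht])
  obtain ⟨M, hM, hp, hexp⟩ := h
  have harg : IsArgument φ p 0 (2 * π) fun t => k * t + (M t).im := by
    refine ⟨by fun_prop, fun t _ => toC.injective ?_⟩
    have h1 : toC (φ t) - toC p = _ := hexp t
    have h2 : ‖φ t - p‖ = Real.exp (M t).re := by
      rw [← toC.norm_map, map_sub, h1, norm_exp]; simp
    rw [map_sub, h1, map_smul, h2]
    apply Complex.ext <;> simp [exp_re, exp_im]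
  rw [windingNumber, angleSwept_eq Real.two_pi_pos.le (fun t _ => hne t) harg]
  have := hp 0
  rw [zero_add] at this
  have hpi := Real.pi_pos
  rw [this]; field_simp; ring


/-! ### The Cauchy–Pompeiu formula for functions of compact support -/

/-- Twice the Wirtinger derivative of `u` with respect to the conjugate variable. -/
noncomputable def dbar (u : ℂ → ℂ) (z : ℂ) : ℂ := fderiv ℝ u z 1 + I * fderiv ℝ u z I

theorem continuous_dbar {u : ℂ → ℂ} (hu : ContDiff ℝ 1 u) : Continuous (dbar u) := by
  have := hu.continuous_fderiv one_ne_zero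
  unfold dbar
  fun_prop

theorem hasCompactSupport_dbar {u : ℂ → ℂ} (hs : HasCompactSupport u) :
    HasCompactSupport (dbar u) := by
  refine (hs.fderiv (𝕜 := ℝ)).mono fun z hz => ?_
  contrapose! hz
  simp only [Function.mem_support, ne_eq, not_not] at hz
  simp [dbar, hz]

theorem integrableOn_polar {A : ℝ × ℝ → ℂ} (hA : Continuous A) {R : ℝ}
    (h0 : ∀ p : ℝ × ℝ, R < p.1 → A p = 0) :
    IntegrableOn A (Ioi (0 : ℝ) ×ˢ Ioo (-π) π) := by
  refine IntegrableOn.of_forall_sdiff_eq_zero (s := Icc 0 R ×ˢ Icc (-π) π)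
    (hA.continuousOn.integrableOn_compact (isCompact_Icc.prod isCompact_Icc))
    (measurableSet_Ioi.prod measurableSet_Ioo) fun p hp => h0 p ?_
  simp only [Set.mem_sdiff, mem_prod, mem_Ioi, mem_Ioo, mem_Icc, not_and] at hp
  by_contra! h
  exact hp.2 ⟨hp.1.1.le, h⟩ hp.1.2.1.le hp.1.2.2.le

/-- In polar coordinates the factor `r` of the area element cancels the pole, and the integrand
becomes `A + i B`, with `A` the radial derivative of `u` and `B` the angular derivative divided by
`r`. Each ray contributes `-u 0` through `A`; each circle contributes `0` through `B` by
periodicity. -/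
theorem integral_dbar_div_zero {u : ℂ → ℂ} (hu : ContDiff ℝ 1 u) (hs : HasCompactSupport u) :
    ∫ w, dbar u w / w = -(2 * π) * u 0 := by
  have hdu : Continuous (fderiv ℝ u) := hu.continuous_fderiv one_ne_zero
  obtain ⟨R, hR0, hR⟩ : ∃ R > 0, ∀ z : ℂ, R < ‖z‖ → u z = 0 ∧ fderiv ℝ u z = 0 := by
    obtain ⟨R, hR⟩ := hs.isBounded.subset_ball (0 : ℂ)
    refine ⟨max R 1, by positivity, fun z hz => ?_⟩
    have hz' : z ∉ tsupport u := fun h => by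
      have := hR h
      rw [mem_ball_zero_iff] at this
      exact absurd (le_max_left R 1) (by linarith)
    exact ⟨image_eq_zero_of_notMem_tsupport hz',
      image_eq_zero_of_notMem_tsupport fun h => hz' (tsupport_fderiv_subset ℝ h)⟩
  set E : ℝ → ℂ := fun θ => exp (θ * I) with hE
  have hEc : Continuous E := by fun_prop
  have hEn : ∀ θ, ‖E θ‖ = 1 := fun θ => norm_exp_ofReal_mul_I θ
  have hEd : ∀ θ, HasDerivAt E (I * E θ) θ := fun θ => by
    have := ((ofRealCLM.hasDerivAt (x := θ)).mul_const I).cexp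
    simpa [hE, mul_comm] using this
  set A : ℝ × ℝ → ℂ := fun p => fderiv ℝ u (p.1 * E p.2) (E p.2)
  set B : ℝ × ℝ → ℂ := fun p => fderiv ℝ u (p.1 * E p.2) (I * E p.2)
  have hA : Continuous A := by fun_prop
  have hB : Continuous B := by fun_prop
  have hfar : ∀ p : ℝ × ℝ, R < p.1 → R < ‖(p.1 * E p.2 : ℂ)‖ := fun p hp => by
    rw [norm_mul, hEn, mul_one, norm_real]; exact hp.trans_le (le_abs_self _)
  have hAi := integrableOn_polar hA (R := R) fun p hp => by simp [A, (hR _ (hfar p hp)).2]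
  have hBi := integrableOn_polar hB (R := R) fun p hp => by simp [B, (hR _ (hfar p hp)).2]
  have hAint : ∫ p in Ioi (0 : ℝ) ×ˢ Ioo (-π) π, A p = -(2 * π) * u 0 := by
    rw [IntegrableOn, Measure.volume_eq_prod, ← Measure.prod_restrict] at hAi
    rw [Measure.volume_eq_prod, ← Measure.prod_restrict, integral_prod_symm _ hAi]
    have : ∀ θ : ℝ, ∫ r in Ioi (0 : ℝ), A (r, θ) = -u 0 := fun θ => by
      have hd : ∀ r : ℝ, HasDerivAt (fun r : ℝ => u (r * E θ)) (A (r, θ)) r := fun r => by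
        have h1 : HasDerivAt (fun r : ℝ => (r * E θ : ℂ)) (E θ) r := by
          simpa using (ofRealCLM.hasDerivAt (x := r)).mul_const (E θ)
        exact ((hu.differentiable one_ne_zero _).hasFDerivAt).comp_hasDerivAt r h1
      have hcd : ContDiff ℝ 1 (fun r : ℝ => u (r * E θ)) :=
        hu.comp (ofRealCLM.contDiff.mul contDiff_const)
      have hcs : HasCompactSupport (fun r : ℝ => u (r * E θ)) := by
        refine HasCompactSupport.intro (isCompact_Icc (a := -R) (b := R)) fun r hr => (hR _ ?_).1
        rw [norm_mul, hEn, mul_one, norm_real, Real.norm_eq_abs]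
        by_contra! h
        exact hr (abs_le.1 h)
      have := hcs.integral_Ioi_deriv_eq hcd 0
      simpa [(hd _).deriv] using this
    simp only [this]
    rw [setIntegral_const, Real.volume_real_Ioo_of_le (by linarith [Real.pi_pos]), real_smul]
    push_cast
    ring
  have hBint : ∫ p in Ioi (0 : ℝ) ×ˢ Ioo (-π) π, B p = 0 := by
    rw [IntegrableOn, Measure.volume_eq_prod, ← Measure.prod_restrict] at hBi
    rw [Measure.volume_eq_prod, ← Measure.prod_restrict, integral_prod _ hBi]
    refine setIntegral_eq_zero_of_forall_eq_zero fun r hr => ?_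
    have hr0 : (r : ℂ) ≠ 0 := by exact_mod_cast ne_of_gt (mem_Ioi.1 hr)
    have hd : ∀ θ : ℝ, HasDerivAt (fun θ : ℝ => u (r * E θ)) (r * B (r, θ)) θ := fun θ => by
      have h1 := ((hu.differentiable one_ne_zero _).hasFDerivAt).comp_hasDerivAt θ
        ((hEd θ).const_mul (r : ℂ))
      have h2 : (r : ℂ) * B (r, θ) = fderiv ℝ u (r * E θ) (r * (I * E θ)) := by
        rw [← real_smul, ← map_smul, real_smul]
      rw [h2]; exact h1
    have h3 := intervalIntegral.integral_eq_sub_of_hasDerivAt (a := -π) (b := π)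
      (fun θ _ => hd θ) (Continuous.intervalIntegrable (by fun_prop) _ _)
    have hper : E π = E (-π) := by simp [hE, exp_neg]
    rw [hper, sub_self, intervalIntegral.integral_const_mul, mul_eq_zero, or_iff_right hr0,
      intervalIntegral.integral_of_le (by linarith [Real.pi_pos]),
      integral_Ioc_eq_integral_Ioo] at h3
    exact h3
  rw [← Complex.integral_comp_polarCoord_symm, polarCoord_target]
  calc _ = ∫ p in Ioi (0 : ℝ) ×ˢ Ioo (-π) π, (A p + I * B p) := by
        refine setIntegral_congr_fun (measurableSet_Ioi.prod measurableSet_Ioo) fun p hp => ?_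
        have hr0 : (p.1 : ℂ) ≠ 0 := by exact_mod_cast ne_of_gt (mem_Ioi.1 hp.1)
        have hEe : Complex.polarCoord.symm p = p.1 * E p.2 := by
          simp [hE, exp_mul_I]
        have hlin : ∀ (L : ℂ →L[ℝ] ℂ) (z : ℂ), L z = z.re * L 1 + z.im * L I := fun L z => by
          conv_lhs => rw [← re_add_im z]
          rw [show (z.re + z.im * I : ℂ) = z.re • (1 : ℂ) + z.im • I by simp, map_add, map_smul,
            map_smul]; simp
        have hE0 : E p.2 ≠ 0 := exp_ne_zero _
        have hre : E p.2 * ((E p.2).re - (E p.2).im * I) = 1 := by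
          have h1 := Complex.mul_conj (E p.2)
          rw [normSq_eq_norm_sq, hEn] at h1
          refine Eq.trans ?_ (h1.trans (by simp))
          congr 1
          apply Complex.ext <;> simp
        simp only [hEe, A, B, dbar]
        rw [hlin _ (E p.2), hlin _ (I * E p.2)]
        have : ∀ a b : ℂ, p.1 • ((a + I * b) / (p.1 * E p.2))
            = (a + I * b) * ((E p.2).re - (E p.2).im * I) := fun a b => by
          rw [real_smul]; field_simp
          linear_combination (-(a + I * b)) * hre
        rw [this]
        simp
        linear_combination (-(E p.2).im * fderiv ℝ u (↑p.1 * E p.2) I) * I_sq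
    _ = _ := by
        rw [integral_add hAi (hBi.const_mul I), integral_const_mul, hAint, hBint]; simp

theorem integral_dbar_div {u : ℂ → ℂ} (hu : ContDiff ℝ 1 u) (hs : HasCompactSupport u) (z : ℂ) :
    ∫ w, dbar u w / (w - z) = -(2 * π) * u z := by
  have h := integral_dbar_div_zero (u := fun w => u (w + z)) (hu.comp (contDiff_id.add contDiff_const))
    (hs.comp_homeomorph (Homeomorph.addRight z))
  rw [zero_add] at h
  rw [← h, ← integral_add_right_eq_self _ z]
  simp [dbar, fderiv_comp_add_right]


/-! ### Green's formula and winding numbers -/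

theorem integrable_indicator_ball_inv_norm (R : ℝ) :
    Integrable ((Metric.ball (0 : ℂ) R).indicator fun w => ‖w‖⁻¹) := by
  rw [integrable_indicator_iff measurableSet_ball,
    integrableOn_fun_norm_addHaar volume (f := fun y : ℝ => y⁻¹)]
  rw [Complex.finrank_real_complex]
  refine (integrableOn_congr_fun (g := fun _ => (1 : ℝ)) (fun y hy => ?_) measurableSet_Ioo).2 ?_
  · simp [mul_inv_cancel₀ hy.1.ne']
  · exact integrableOn_const (by simp)

section Green

variable {p : ℂ → ℂ} {c c' : ℝ → ℂ}

/-- Justifies Fubini: the kernel `1/|w|` is locally integrable in the plane, and both `dbar p` and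
the curve are bounded. -/
theorem integrable_dbar_mul_cauchy (hp : ContDiff ℝ 1 p) (hs : HasCompactSupport p)
    (hc : Continuous c) (hc' : Continuous c') :
    Integrable (fun x : ℝ × ℂ => dbar p x.2 * (c' x.1 / (c x.1 - x.2)))
      ((volume.restrict (Ioc 0 (2 * π))).prod volume) := by
  have hpc := continuous_dbar hp
  obtain ⟨C, hC⟩ := hpc.bounded_above_of_compact_support (hasCompactSupport_dbar hs)
  obtain ⟨R₁, hR₁⟩ := (hasCompactSupport_dbar hs).isBounded.subset_ball (0 : ℂ)
  obtain ⟨R₂, hR₂⟩ := (isCompact_Icc.image hc).isBounded.subset_ball (0 : ℂ)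
    (s := c '' Icc 0 (2 * π))
  obtain ⟨C', hC'⟩ := (isCompact_Icc (a := (0 : ℝ)) (b := 2 * π)).exists_bound_of_continuousOn
    hc'.continuousOn
  -- The radius `R₁ + R₂` covers every difference of a point of the support of `dbar p` and a point
  -- of the curve.
  set κ : ℂ → ℝ := (Metric.ball (0 : ℂ) (R₁ + R₂)).indicator fun w => ‖w‖⁻¹ with hκ
  have hκi : Integrable κ := integrable_indicator_ball_inv_norm _
  have hκm : Measurable κ := by
    refine Measurable.indicator ?_ measurableSet_ball
    fun_prop
  have hκ0 : ∀ w, 0 ≤ κ w := fun w => indicator_nonneg (fun _ _ => by positivity) _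
  have hdom : Integrable (fun x : ℝ × ℂ => C * C' * κ (x.2 - c x.1))
      ((volume.restrict (Ioc 0 (2 * π))).prod volume) := by
    refine Integrable.const_mul ?_ _
    have hm : Measurable fun x : ℝ × ℂ => κ (x.2 - c x.1) :=
      hκm.comp (measurable_snd.sub (hc.measurable.comp measurable_fst))
    rw [integrable_prod_iff hm.aestronglyMeasurable]
    refine ⟨.of_forall fun t => hκi.comp_sub_right (c t), ?_⟩
    have : ∀ t, ∫ w, ‖κ (w - c t)‖ = ∫ w, ‖κ w‖ := fun t =>
      integral_sub_right_eq_self (fun w => ‖κ w‖) (c t)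
    simp only [this]
    exact integrable_const _
  refine hdom.mono' ?_ ?_
  · refine Measurable.aestronglyMeasurable ?_
    exact (hpc.measurable.comp measurable_snd).mul ((hc'.measurable.comp measurable_fst).div
      ((hc.measurable.comp measurable_fst).sub measurable_snd))
  · have hmem : ∀ᵐ x : ℝ × ℂ ∂((volume.restrict (Ioc 0 (2 * π))).prod volume),
        x.1 ∈ Ioc 0 (2 * π) :=
      Measure.quasiMeasurePreserving_fst.ae (ae_restrict_mem measurableSet_Ioc)
    filter_upwards [hmem] with x hx
    have hxI : x.1 ∈ Icc 0 (2 * π) := Ioc_subset_Icc_self hx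
    have hC0 : 0 ≤ C := (norm_nonneg _).trans (hC 0)
    have hC'0 : 0 ≤ C' := (norm_nonneg _).trans (hC' _ hxI)
    by_cases hD : dbar p x.2 = 0
    · rw [hD, zero_mul, norm_zero]; exact mul_nonneg (by positivity) (hκ0 _)
    · have h1 : ‖x.2‖ < R₁ := mem_ball_zero_iff.1 (hR₁ (subset_tsupport _ hD))
      have h2 : ‖c x.1‖ < R₂ := mem_ball_zero_iff.1 (hR₂ (mem_image_of_mem _ hxI))
      have h3 : κ (x.2 - c x.1) = ‖c x.1 - x.2‖⁻¹ := by
        rw [hκ, indicator_of_mem, norm_sub_rev]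
        rw [mem_ball_zero_iff]
        exact (norm_sub_le _ _).trans_lt (by linarith)
      rw [h3, norm_mul, norm_div, div_eq_mul_inv, ← mul_assoc]
      gcongr
      · exact hC _
      · exact hC' _ hxI

theorem integrable_dbar_mul_integral (hp : ContDiff ℝ 1 p) (hs : HasCompactSupport p)
    (hc : Continuous c) (hc' : Continuous c') :
    Integrable fun w => dbar p w * ∫ t in (0 : ℝ)..2 * π, c' t / (c t - w) := by
  have := (integrable_dbar_mul_cauchy hp hs hc hc').integral_prod_right
  refine this.congr (.of_forall fun w => ?_)
  simp only
  rw [integral_const_mul, intervalIntegral.integral_of_le Real.two_pi_pos.le]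

/-- Cauchy–Pompeiu at each point of the curve, followed by exchanging the integrals. For a closed
curve the inner integral on the right is `2πi` times its winding number around `w`, so this is a
Green formula that needs no regularity of the enclosed region. -/
theorem integral_comp_mul_deriv_eq (hp : ContDiff ℝ 1 p) (hs : HasCompactSupport p)
    (hc : Continuous c) (hc' : Continuous c') :
    2 * π * ∫ t in (0 : ℝ)..2 * π, p (c t) * c' t =
      ∫ w, dbar p w * ∫ t in (0 : ℝ)..2 * π, c' t / (c t - w) := by
  have hint := integrable_dbar_mul_cauchy hp hs hc hc'
  calc _ = ∫ t in Ioc 0 (2 * π), ∫ w, dbar p w * (c' t / (c t - w)) := by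
        rw [intervalIntegral.integral_of_le Real.two_pi_pos.le, ← integral_const_mul]
        refine integral_congr_ae (.of_forall fun t => ?_)
        have : ∀ w, dbar p w * (c' t / (c t - w)) = (-c' t) * (dbar p w / (w - c t)) := fun w => by
          rw [← neg_sub (c t) w, div_neg]; ring
        simp only [this]
        rw [integral_const_mul, integral_dbar_div hp hs]
        ring
    _ = ∫ w, ∫ t in Ioc 0 (2 * π), dbar p w * (c' t / (c t - w)) := integral_integral_swap hint
    _ = _ := by
        refine integral_congr_ae (.of_forall fun w => ?_)
        simp only
        rw [integral_const_mul, intervalIntegral.integral_of_le Real.two_pi_pos.le]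

end Green

/-- The curve is the image of the plane under `z ↦ c (re z)`, whose differential has rank at most
one everywhere. -/
theorem volume_range_curve {c c' : ℝ → ℂ} (hd : ∀ t, HasDerivAt c (c' t) t) :
    volume (range c) = 0 := by
  have h := addHaar_image_eq_zero_of_det_fderivWithin_eq_zero volume (s := univ)
    (f := fun z : ℂ => c z.re) (f' := fun z => reCLM.smulRight (c' z.re))
    (fun z _ => ((hd z.re).hasFDerivAt.comp z reCLM.hasFDerivAt).hasFDerivWithinAt.congr_fderiv
      (by ext; simp)) (fun z _ => ?_)
  · refine measure_mono_null ?_ h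
    rintro _ ⟨t, rfl⟩
    exact ⟨t, mem_univ _, by simp⟩
  · by_contra hdet
    have : IsUnit (LinearMap.det (reCLM.smulRight (c' z.re) : ℂ →L[ℝ] ℂ).toLinearMap) :=
      isUnit_iff_ne_zero.2 hdet
    have hI := (LinearMap.equivOfIsUnitDet this).injective (a₁ := I) (a₂ := 0) (by simp)
    exact I_ne_zero hI

/-! ### The differential of the argument of a function -/

/-- The differential of the argument of `f`, which is `a dx + b dy`, encoded as `a - b i`. -/
noncomputable def argForm (f : ℂ → ℂ) (z : ℂ) : ℂ :=
  ((fderiv ℝ f z 1 / f z).im : ℂ) - ((fderiv ℝ f z I / f z).im : ℂ) * I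

theorem re_argForm_mul (f : ℂ → ℂ) (z v : ℂ) :
    (argForm f z * v).re = (fderiv ℝ f z v / f z).im := by
  have : fderiv ℝ f z v = v.re * fderiv ℝ f z 1 + v.im * fderiv ℝ f z I := by
    conv_lhs => rw [← re_add_im v]
    rw [show (v.re + v.im * I : ℂ) = v.re • (1 : ℂ) + v.im • I by simp, map_add, map_smul,
      map_smul]; simp
  rw [this, add_div, mul_div_assoc, mul_div_assoc]
  simp [argForm]
  ring

section argForm

variable {f : ℂ → ℂ} {z : ℂ}

theorem contDiffAt_argForm (hf : ContDiffAt ℝ 2 f z) (h0 : f z ≠ 0) :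
    ContDiffAt ℝ 1 (argForm f) z := by
  have hd : ContDiffAt ℝ 1 (fderiv ℝ f) z := hf.fderiv_right (by norm_num)
  have hq : ∀ v, ContDiffAt ℝ 1 (fun z => ((fderiv ℝ f z v / f z).im : ℂ)) z := fun v =>
    ofRealCLM.contDiff.contDiffAt.comp z (imCLM.contDiff.contDiffAt.comp z
      ((hd.clm_apply contDiffAt_const).mul ((hf.of_le (by norm_num)).inv h0)))
  exact (hq 1).sub ((hq I).mul contDiffAt_const)

/-- For `a - b i` the imaginary part of `dbar` is `∂a/∂y - ∂b/∂x`. It vanishes because `a dx + b dy`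
is closed, being the imaginary part of `df / f`; this rests on the symmetry of the second derivative
of `f`. -/
theorem dbar_argForm_im (hf : ContDiffAt ℝ 2 f z) (h0 : f z ≠ 0) : (dbar (argForm f) z).im = 0 := by
  have hd : DifferentiableAt ℝ (fderiv ℝ f) z :=
    (hf.fderiv_right (m := 1) (by norm_num)).differentiableAt one_ne_zero
  have hf1 : HasFDerivAt f (fderiv ℝ f z) z := (hf.differentiableAt two_ne_zero).hasFDerivAt
  have hq : ∀ v, DifferentiableAt ℝ (fun z => fderiv ℝ f z v / f z) z := fun v =>
    (hd.clm_apply (differentiableAt_const v)).mul (hf1.differentiableAt.inv h0)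
  have hqd : ∀ v w, fderiv ℝ (fun z => fderiv ℝ f z v / f z) z w =
      fderiv ℝ (fderiv ℝ f) z w v / f z - fderiv ℝ f z v * fderiv ℝ f z w / f z ^ 2 := fun v w => by
    have h1 : HasFDerivAt (fun z => fderiv ℝ f z v)
        ((ContinuousLinearMap.apply ℝ ℂ v).comp (fderiv ℝ (fderiv ℝ f) z)) z :=
      (ContinuousLinearMap.apply ℝ ℂ v).hasFDerivAt.comp z hd.hasFDerivAt
    have h2 : HasFDerivAt (fun z => (f z)⁻¹) _ z :=
      ((hasDerivAt_inv h0).hasFDerivAt.restrictScalars ℝ).comp z hf1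
    have h3 : HasFDerivAt (fun z => fderiv ℝ f z v / f z) _ z := h1.mul h2
    rw [h3.fderiv]
    simp
    field_simp
    ring
  have hsym : ∀ v w, fderiv ℝ (fun z => fderiv ℝ f z v / f z) z w =
      fderiv ℝ (fun z => fderiv ℝ f z w / f z) z v := fun v w => by
    rw [hqd, hqd, (hf.isSymmSndFDerivAt (by simp)) w v]; ring
  have hcomp : ∀ v, HasFDerivAt (fun z => ((fderiv ℝ f z v / f z).im : ℂ))
      (ofRealCLM.comp (imCLM.comp (fderiv ℝ (fun z => fderiv ℝ f z v / f z) z))) z := fun v =>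
    ofRealCLM.hasFDerivAt.comp z (imCLM.hasFDerivAt.comp z (hq v).hasFDerivAt)
  have hder : HasFDerivAt (argForm f) _ z := (hcomp 1).sub ((hcomp I).mul_const I)
  rw [dbar, hder.fderiv]
  simp [hsym 1 I]

end argForm

/-! ### Winding numbers of images of null-homologous cycles -/

section Homology

variable {ι : Type*} [Fintype ι] {K U : Set ℂ} {f : ℂ → ℂ} {c c' : ι → ℝ → ℂ}

/-- Cauchy–Pompeiu needs a compactly supported `C¹` function on all of `ℂ`. Agreement on a
neighbourhood of each point of `K`, and not only on `K`, preserves `dbar` there as well. -/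
theorem exists_cutoff_argForm (hK : IsCompact K) (hU : IsOpen U) (hKU : K ⊆ U)
    (hf : ContDiffOn ℝ 2 f U) (h0 : ∀ z ∈ U, f z ≠ 0) :
    ∃ p : ℂ → ℂ, ContDiff ℝ 1 p ∧ HasCompactSupport p ∧ ∀ z ∈ K, p =ᶠ[𝓝 z] argForm f := by
  obtain ⟨K', hK', hKK', hK'U⟩ := exists_compact_between hK hU hKU
  obtain ⟨χ, h1, hχ0, -⟩ := exists_contMDiffMap_one_nhds_of_subset_interior
    (n := 1) (modelWithCornersSelf ℝ ℂ) hK.isClosed hKK'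
  have hχ : ContDiff ℝ 1 (fun z => (χ z : ℂ)) := ofRealCLM.contDiff.comp χ.contMDiff.contDiff
  have hsupp : ∀ z ∉ K', (χ z : ℂ) * argForm f z = 0 := fun z hz => by simp [hχ0 z hz]
  refine ⟨fun z => χ z * argForm f z, contDiff_iff_contDiffAt.2 fun z => ?_,
    HasCompactSupport.intro hK' hsupp, fun z hz => ?_⟩
  · by_cases hz : z ∈ U
    · exact hχ.contDiffAt.mul
        (contDiffAt_argForm (hf.contDiffAt (hU.mem_nhds hz)) (h0 z hz))
    · refine (contDiffAt_const (c := (0 : ℂ))).congr_of_eventuallyEq ?_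
      filter_upwards [hK'.isClosed.isOpen_compl.mem_nhds fun h => hz (hK'U h)] with w hw
      exact hsupp w hw
  · filter_upwards [eventually_nhdsSet_iff_forall.1 h1 z hz] with w hw
    simp [hw]

/-- If a cycle `∑ mᵢ cᵢ` in the compact set `K` does not wind around any point outside `K`, then
its image under a map `f` without zeros near `K` does not wind around the origin. -/
theorem sum_winding_comp_eq_zero (hK : IsCompact K) (hU : IsOpen U) (hKU : K ⊆ U)
    (hf : ContDiffOn ℝ 2 f U) (h0 : ∀ z ∈ U, f z ≠ 0)
    (hd : ∀ i t, HasDerivAt (c i) (c' i t) t) (hc' : ∀ i, Continuous (c' i))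
    (hcp : ∀ i, Function.Periodic (c i) (2 * π)) (hcK : ∀ i t, c i t ∈ K) (m : ι → ℤ)
    (hw : ∀ w ∉ K, ∀ k : ι → ℤ, (∀ i, HasWinding (fun t => c i t - w) (k i)) →
      ∑ i, m i * k i = 0)
    {k : ι → ℤ} (hk : ∀ i, HasWinding (fun t => f (c i t)) (k i)) : ∑ i, m i * k i = 0 := by
  obtain ⟨p, hp, hs, hpK⟩ := exists_cutoff_argForm hK hU hKU hf h0
  have hc : ∀ i, Continuous (c i) := fun i =>
    continuous_iff_continuousAt.2 fun t => (hd i t).continuousAt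
  have hpc : ∀ i, Continuous fun t => p (c i t) * c' i t := fun i =>
    (hp.continuous.comp (hc i)).mul (hc' i)
  have hleft : ∀ i, (∫ t in (0 : ℝ)..2 * π, p (c i t) * c' i t).re = k i * (2 * π) := fun i => by
    have hfU : ∀ t, HasFDerivAt f (fderiv ℝ f (c i t)) (c i t) := fun t =>
      ((hf.contDiffAt (hU.mem_nhds (hKU (hcK i t)))).differentiableAt two_ne_zero).hasFDerivAt
    have hfc : Continuous fun t => fderiv ℝ f (c i t) :=
      continuous_iff_continuousAt.2 fun t => ContinuousAt.comp (g := fderiv ℝ f)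
        ((hf.contDiffAt (hU.mem_nhds (hKU (hcK i t)))).fderiv_right (m := 1)
          (by norm_num)).continuousAt (hc i).continuousAt
    have hψ : Continuous fun t => fderiv ℝ f (c i t) (c' i t) := hfc.clm_apply (hc' i)
    have h1 := (hk i).integral_eq (ψ' := fun t => fderiv ℝ f (c i t) (c' i t))
      (fun t => (hfU t).comp_hasDerivAt t (hd i t)) hψ
    have h2 := congrArg Complex.im h1
    have hq : Continuous fun t => fderiv ℝ f (c i t) (c' i t) / f (c i t) :=
      hψ.div (hk i).continuous (hk i).ne_zero
    rw [← imCLM_apply, ← imCLM.intervalIntegral_comp_comm (hq.intervalIntegrable _ _)] at h2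
    rw [← reCLM_apply, ← reCLM.intervalIntegral_comp_comm ((hpc i).intervalIntegrable _ _)]
    simp only [reCLM_apply, imCLM_apply] at h2 ⊢
    have h3 : ∀ t, (p (c i t) * c' i t).re =
        (fderiv ℝ f (c i t) (c' i t) / f (c i t)).im := fun t => by
      rw [(hpK _ (hcK i t)).eq_of_nhds, re_argForm_mul]
    simp only [h3, h2]
    simp
  have hnull : ∀ᵐ w, ∀ i, w ∉ range (c i) := by
    rw [ae_all_iff]
    exact fun i => measure_eq_zero_iff_ae_notMem.1 (volume_range_curve (hd i))
  have hzero : ∀ᵐ w, (∑ i, (m i : ℂ) *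
      (dbar p w * ∫ t in (0 : ℝ)..2 * π, c' i t / (c i t - w))).re = 0 := by
    filter_upwards [hnull] with w hwr
    have hex : ∀ i, ∃ l, HasWinding (fun t => c i t - w) l := fun i =>
      exists_hasWinding ((hc i).sub continuous_const) (fun t => by simp only [hcp i t])
        fun t ht => hwr i ⟨t, sub_eq_zero.1 ht⟩
    choose l hl using hex
    have h1 : ∀ i, ∫ t in (0 : ℝ)..2 * π, c' i t / (c i t - w) = l i * (2 * π * I) := fun i =>
      (hl i).integral_eq (fun t => (hd i t).sub_const w) (hc' i)
    simp only [h1]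
    have h2 : ∑ i, (m i : ℂ) * (dbar p w * (l i * (2 * π * I))) =
        dbar p w * (2 * π * I) * ((∑ i, m i * l i : ℤ) : ℂ) := by
      push_cast
      rw [Finset.mul_sum]
      exact Finset.sum_congr rfl fun i _ => by ring
    rw [h2]
    by_cases hwK : w ∈ K
    · have h3 : (dbar p w).im = 0 := by
        rw [dbar, (hpK w hwK).fderiv_eq]
        exact dbar_argForm_im (hf.contDiffAt (hU.mem_nhds (hKU hwK))) (h0 w (hKU hwK))
      simp [h3]
    · rw [hw w hwK l hl]; simp
  have hsum : ∑ i, (m i : ℂ) * (2 * π * ∫ t in (0 : ℝ)..2 * π, p (c i t) * c' i t) =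
      ∫ w, ∑ i, (m i : ℂ) * (dbar p w * ∫ t in (0 : ℝ)..2 * π, c' i t / (c i t - w)) := by
    have hint := fun i => integrable_dbar_mul_integral hp hs (hc i) (hc' i)
    rw [integral_finsetSum _ fun i _ => (hint i).const_mul _]
    refine Finset.sum_congr rfl fun i _ => ?_
    rw [integral_const_mul, integral_comp_mul_deriv_eq hp hs (hc i) (hc' i)]
  have hint : Integrable fun w => ∑ i, (m i : ℂ) *
      (dbar p w * ∫ t in (0 : ℝ)..2 * π, c' i t / (c i t - w)) :=
    integrable_finsetSum _ fun i _ =>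
      (integrable_dbar_mul_integral hp hs (hc i) (hc' i)).const_mul _
  have hre := congrArg Complex.re hsum
  rw [← reCLM_apply (∫ w, _), ← reCLM.integral_comp_comm hint] at hre
  simp only [reCLM_apply] at hre
  rw [integral_congr_ae (g := fun _ => (0 : ℝ)) hzero, integral_zero, re_sum] at hre
  have h4 : ∀ i, ((m i : ℂ) * (2 * π * ∫ t in (0 : ℝ)..2 * π, p (c i t) * c' i t)).re =
      (2 * π) ^ 2 * ((m i * k i : ℤ) : ℝ) := fun i => by
    have : ((m i : ℂ) * (2 * π * ∫ t in (0 : ℝ)..2 * π, p (c i t) * c' i t)) =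
      ((m i * (2 * π) : ℝ) : ℂ) * ∫ t in (0 : ℝ)..2 * π, p (c i t) * c' i t := by
        push_cast; ring
    rw [this, re_ofReal_mul, hleft]; push_cast; ring
  simp only [h4] at hre
  rw [← Finset.mul_sum, mul_eq_zero, or_iff_right (by positivity)] at hre
  exact_mod_cast hre

end Homology


/-! ### Hopf's Umlaufsatz -/

/-- `c` is a `2π`-periodic regular parametrization, with velocity `c'`, of a simple closed curve. -/
structure IsSimpleLoop (c c' : ℝ → ℂ) : Prop where
  hasDerivAt : ∀ t, HasDerivAt c (c' t) t
  continuous_deriv : Continuous c'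
  periodic : Function.Periodic c (2 * π)
  deriv_ne_zero : ∀ t, c' t ≠ 0
  injective : ∀ s t, c s = c t → ∃ n : ℤ, s = t + n * (2 * π)

theorem log_neg_of_im_pos {z : ℂ} (hz : 0 < z.im) : log (-z) = log z - π * I := by
  rw [log, log, norm_neg, arg_neg_eq_arg_sub_pi_of_im_pos hz]; push_cast; ring

theorem log_neg_of_im_neg {z : ℂ} (hz : z.im < 0) : log (-z) = log z + π * I := by
  rw [log, log, norm_neg, arg_neg_eq_arg_add_pi_of_im_neg hz]; push_cast; ring

/-- The principal logarithm of `-ρ` on the short arc and that of `ρ` on the long arc give continuous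
branches. Passing from one to the other costs `πi` at each of the two junctions, and everything else
cancels. -/
theorem HasWinding.eq_one_of_slitPlane {ρ : ℝ → ℂ} {k : ℤ} (h : HasWinding ρ k) {δ : ℝ}
    (hδ : 0 < δ) (hδπ : δ < π) (hneg : ∀ t ∈ Icc (-δ) δ, -ρ t ∈ slitPlane)
    (hpos : ∀ t ∈ Icc δ (2 * π - δ), ρ t ∈ slitPlane) (h1 : (ρ δ).im < 0)
    (h2 : 0 < (ρ (-δ)).im) : k = 1 := by
  have hρ := h.continuous
  have hper := h.periodic (-δ)
  have hne := h.ne_zero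
  obtain ⟨M, hM, hp, hexp⟩ := h
  have e1 := log_sub_log_eq (L := fun t => k * t * I + M t) (L' := fun t => log (-ρ t) + π * I)
    (isPreconnected_Icc (a := -δ) (b := δ)) (by fun_prop)
    ((hρ.neg.continuousOn.clog hneg).add continuousOn_const)
    (fun t _ => by
      rw [← hexp, exp_add, exp_log (neg_ne_zero.2 (hne t)), exp_pi_mul_I]; simp)
    (left_mem_Icc.2 (by linarith)) (right_mem_Icc.2 (by linarith))
  have e2 := log_sub_log_eq (L := fun t => k * t * I + M t) (L' := fun t => log (ρ t))
    (isPreconnected_Icc (a := δ) (b := 2 * π - δ)) (by fun_prop)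
    (hρ.continuousOn.clog hpos)
    (fun t _ => by rw [← hexp, exp_log (hne t)])
    (left_mem_Icc.2 (by linarith)) (right_mem_Icc.2 (by linarith))
  have e3 : ρ (2 * π - δ) = ρ (-δ) := by rw [← hper]; congr 1; ring
  have e4 : M (2 * π - δ) = M (-δ) := by rw [← hp (-δ)]; congr 1; ring
  simp only [e3, e4, log_neg_of_im_neg h1, log_neg_of_im_pos h2] at e1 e2
  have : (k : ℂ) * (2 * π * I) = 1 * (2 * π * I) := by
    push_cast at e1 e2
    linear_combination e1 + e2
  exact_mod_cast mul_right_cancel₀ two_pi_I_ne_zero this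

theorem hasWinding_zero_of_im_pos {ψ : ℝ → ℂ} (hc : Continuous ψ)
    (hp : Function.Periodic ψ (2 * π)) (h : ∀ t, 0 < (ψ t).im) : HasWinding ψ 0 :=
  .of_slitPlane hc hp fun t => Or.inr (h t).ne'

namespace IsSimpleLoop

variable {c c' : ℝ → ℂ}

theorem continuous (h : IsSimpleLoop c c') : Continuous c :=
  continuous_iff_continuousAt.2 fun t => (h.hasDerivAt t).continuousAt

theorem periodic_deriv (h : IsSimpleLoop c c') : Function.Periodic c' (2 * π) := fun t => by
  have h1 := (h.hasDerivAt (t + 2 * π)).comp_add_const t (2 * π)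
  rw [show (fun x => c (x + 2 * π)) = c from funext h.periodic] at h1
  exact h1.unique (h.hasDerivAt t)

theorem shift (h : IsSimpleLoop c c') (a : ℝ) (z : ℂ) :
    IsSimpleLoop (fun t => c (t + a) - z) (fun t => c' (t + a)) where
  hasDerivAt t := ((h.hasDerivAt (t + a)).comp_add_const t a).sub_const z
  continuous_deriv := h.continuous_deriv.comp (by fun_prop)
  periodic t := by simp only; rw [add_right_comm, h.periodic]
  deriv_ne_zero t := h.deriv_ne_zero _
  injective s t hst := by
    obtain ⟨n, hn⟩ := h.injective _ _ (sub_left_injective hst)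
    exact ⟨n, by linarith⟩

theorem reflect (h : IsSimpleLoop c c') :
    IsSimpleLoop (fun t => -starRingEnd ℂ (c t)) (fun t => -starRingEnd ℂ (c' t)) where
  hasDerivAt t := ((conjCLE.toContinuousLinearMap.hasFDerivAt (x := c t)).comp_hasDerivAt t
    (h.hasDerivAt t)).neg
  continuous_deriv := (continuous_conj.comp h.continuous_deriv).neg
  periodic t := by simp only [h.periodic t]
  deriv_ne_zero t := by simpa using h.deriv_ne_zero t
  injective s t hst := h.injective s t ((starRingEnd ℂ).injective (neg_injective hst))

/-- A simple loop with lowest point `c 0 = 0`, traversed there from left to right, winds once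
around a point slightly above. -/
theorem exists_hasWinding_one (h : IsSimpleLoop c c') (h0 : c 0 = 0) (him : ∀ t, 0 ≤ (c t).im)
    (hv : 0 < (c' 0).re) : ∃ w, HasWinding (fun t => c t - w) 1 := by
  obtain ⟨δ, hδ, hδ1, hsign⟩ : ∃ δ > 0, δ < 1 ∧ ∀ t, t ≠ 0 → |t| ≤ δ → 0 < t * (c t).re := by
    have h1 : HasDerivAt (fun t => (c t).re) (c' 0).re 0 :=
      reCLM.hasFDerivAt.comp_hasDerivAt 0 (h.hasDerivAt 0)
    have h2 := (hasDerivAt_iff_tendsto_slope.1 h1).eventually (lt_mem_nhds hv)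
    obtain ⟨δ, hδ, h3⟩ := Metric.eventually_nhds_iff.1 (eventually_nhdsWithin_iff.1 h2)
    refine ⟨min (δ / 2) (1 / 2), by positivity, by
      linarith [min_le_right (δ / 2) (1 / 2 : ℝ)], fun t ht htδ => ?_⟩
    have h4 := h3 (y := t) (by
      rw [Real.dist_eq, sub_zero]; linarith [min_le_left (δ / 2) (1 / 2 : ℝ)]) ht
    rw [slope_def_field, h0, sub_zero, zero_re, sub_zero] at h4
    have := mul_pos h4 (sq_pos_of_ne_zero ht)
    rwa [show (c t).re / t * t ^ 2 = t * (c t).re by field_simp] at this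
  have hπ := Real.pi_gt_three
  -- By injectivity the curve returns to `0` only at multiples of the period, so the arc away from
  -- time `0` keeps a positive distance from `0`.
  obtain ⟨ε, hε, hfar⟩ : ∃ ε > 0, ∀ t ∈ Icc δ (2 * π - δ), ε < ‖c t‖ := by
    obtain ⟨t₀, ht₀, hmin⟩ := (isCompact_Icc (a := δ) (b := 2 * π - δ)).exists_isMinOn
      (nonempty_Icc.2 (by linarith)) h.continuous.norm.continuousOn
    have hpos : 0 < ‖c t₀‖ := by
      rw [norm_pos_iff, ← h0]
      intro he
      obtain ⟨n, hn⟩ := h.injective _ _ he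
      rw [zero_add] at hn
      have h1 : (0 : ℝ) < n := by
        by_contra! hc
        nlinarith [ht₀.1]
      have h2 : (n : ℝ) < 1 := by
        by_contra! hc
        nlinarith [ht₀.2]
      have h1' : 0 < n := by exact_mod_cast h1
      have h2' : n < 1 := by exact_mod_cast h2
      omega
    exact ⟨‖c t₀‖ / 2, by positivity, fun t ht => (half_lt_self hpos).trans_le (hmin ht)⟩
  have hlow : HasWinding (fun t => c t + ε * I) 0 :=
    hasWinding_zero_of_im_pos (h.continuous.add continuous_const)
      (fun t => by simp only [h.periodic t]) fun t => by simpa using by linarith [him t]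
  have hne : ∀ t, c t + ε * I ≠ 0 := hlow.ne_zero
  set N : ℝ → ℝ := fun t => normSq (c t + ε * I)
  have hN : ∀ t, 0 < N t := fun t => normSq_pos.2 (hne t)
  -- The point `-ε i` lies below the curve, so the denominator does not wind, and `ρ` winds as the
  -- curve does around `ε i`. Its real part is positive where `‖c t‖ > ε`, and its imaginary part
  -- has the sign of `-re (c t)`.
  set ρ : ℝ → ℂ := fun t => (c t - ε * I) / (c t + ε * I)
  have hre : ∀ t, (ρ t).re = (normSq (c t) - ε ^ 2) / N t := fun t => by
    simp only [ρ, N, div_re]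
    rw [← add_div]
    congr 1
    simp [normSq_apply]
    ring
  have him' : ∀ t, (ρ t).im = -(2 * ε * (c t).re) / N t := fun t => by
    simp only [ρ, N, div_im]
    rw [← sub_div]
    congr 1
    simp
    ring
  have hpos : ∀ t ∈ Icc δ (2 * π - δ), 0 < (ρ t).re := fun t ht => by
    rw [hre, normSq_eq_norm_sq]
    have := hfar t ht
    exact div_pos (by nlinarith) (hN t)
  have hneg : ∀ t ∈ Icc (-δ) δ, -ρ t ∈ slitPlane := fun t ht => by
    rcases eq_or_ne t 0 with rfl | ht0
    · left
      rw [neg_re, hre, h0]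
      have := hN 0
      simp only [map_zero, zero_sub, neg_div, neg_neg]
      positivity
    · right
      have := hsign t ht0 (abs_le.2 ht)
      rw [neg_im, him', neg_div, neg_neg]
      have h1 : (c t).re ≠ 0 := fun he => by simp [he] at this
      have := (hN t).ne'
      positivity
  have hup0 : ∀ t, c t - ε * I ≠ 0 := by
    have hcov : ∀ t ∈ Ico (-δ) (-δ + 2 * π), c t - ε * I ≠ 0 := fun t ht he => by
      have hρ0 : ρ t = 0 := by simp [ρ, he]
      rcases le_total t δ with htδ | htδ
      · have := slitPlane_ne_zero (hneg t ⟨ht.1, htδ⟩)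
        simp [hρ0] at this
      · have := hpos t ⟨htδ, by linarith [ht.2]⟩
        simp [hρ0] at this
    intro t
    obtain ⟨s, hs, hst⟩ := h.periodic.exists_mem_Ico Real.two_pi_pos t (-δ)
    rw [hst]
    exact hcov s hs
  obtain ⟨k, hk⟩ := exists_hasWinding (ψ := ρ)
    ((h.continuous.sub continuous_const).div (h.continuous.add continuous_const) hne)
    (fun t => by simp only [ρ, h.periodic t]) fun t => div_ne_zero (hup0 t) (hne t)
  have hk1 : k = 1 := by
    refine hk.eq_one_of_slitPlane hδ (by linarith) hneg (fun t ht => Or.inl (hpos t ht)) ?_ ?_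
    · rw [him', neg_div, neg_lt_zero]
      have := hsign δ hδ.ne' (abs_of_pos hδ).le
      have h1 : 0 < (c δ).re := pos_of_mul_pos_right this hδ.le
      have := hN δ
      positivity
    · rw [him']
      have := hsign (-δ) (by linarith) (by rw [abs_neg, abs_of_pos hδ])
      have h1 : 0 < -(c (-δ)).re := by nlinarith
      have := hN (-δ)
      exact div_pos (by nlinarith) this
  refine ⟨ε * I, ?_⟩
  have := hk.mul hlow
  rw [add_zero, hk1] at this
  convert this using 2 with t
  simp only [ρ]
  rw [div_mul_cancel₀ _ (hne t)]

/-- The mean velocity of `c` between the times `s` and `s + u`. -/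
noncomputable def meanVelocity (c' : ℝ → ℂ) (s u : ℝ) : ℂ := ∫ x in (0 : ℝ)..1, c' (s + x * u)

theorem mul_meanVelocity (h : IsSimpleLoop c c') (s u : ℝ) :
    u * meanVelocity c' s u = c (s + u) - c s := by
  have hd : ∀ x : ℝ, HasDerivAt (fun x => c (s + x * u)) (u * c' (s + x * u)) x := fun x => by
    have h1 : HasDerivAt (fun x : ℝ => s + x * u) u x := by
      simpa using ((hasDerivAt_id x).mul_const u).const_add s
    exact (h.hasDerivAt (s + x * u)).scomp x h1
  have := h.continuous_deriv
  have h2 := intervalIntegral.integral_eq_sub_of_hasDerivAt (a := 0) (b := 1)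
    (fun x _ => hd x) (Continuous.intervalIntegrable (by fun_prop) _ _)
  rw [intervalIntegral.integral_const_mul] at h2
  simpa [meanVelocity] using h2

theorem continuous_meanVelocity (h : IsSimpleLoop c c') :
    Continuous fun p : ℝ × ℝ => meanVelocity c' p.1 p.2 := by
  have := h.continuous_deriv
  exact intervalIntegral.continuous_parametric_intervalIntegral_of_continuous' (by fun_prop) _ _

/-- For `0 < u < 2π` a positive multiple of the chord from `c s` to `c (s + u)`. -/
noncomputable def chord (c' : ℝ → ℂ) (s u : ℝ) : ℂ :=
  meanVelocity c' s u - meanVelocity c' s (u - 2 * π)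

/-- At `u = 0` the second mean is taken over a whole period and vanishes; at `u = 2π` the first one
does. Thus `chord` extends the chord direction continuously, without zeros, to both ends. -/
theorem chord_zero (h : IsSimpleLoop c c') (s : ℝ) : chord c' s 0 = c' s := by
  have h1 := h.mul_meanVelocity s (-(2 * π))
  rw [← sub_eq_add_neg, h.periodic.sub_eq, sub_self, mul_eq_zero,
    or_iff_right (by simp [Real.pi_ne_zero])] at h1
  rw [chord, zero_sub, h1]
  simp [meanVelocity]

theorem chord_two_pi (h : IsSimpleLoop c c') (s : ℝ) : chord c' s (2 * π) = -c' s := by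
  have h1 := h.mul_meanVelocity s (2 * π)
  rw [h.periodic, sub_self, mul_eq_zero, or_iff_right (by simp [Real.pi_ne_zero])] at h1
  rw [chord, h1]
  simp [meanVelocity]

theorem exists_chord_eq (h : IsSimpleLoop c c') (s : ℝ) {u : ℝ} (hu : u ∈ Ioo 0 (2 * π)) :
    ∃ r : ℝ, 0 < r ∧ chord c' s u = r * (c (s + u) - c s) := by
  have hu1 : 0 < u := hu.1
  have hu2 : 0 < 2 * π - u := by linarith [hu.2]
  refine ⟨1 / u + 1 / (2 * π - u), by positivity, ?_⟩
  have h1 := h.mul_meanVelocity s u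
  have h2 := h.mul_meanVelocity s (u - 2 * π)
  rw [← add_sub_assoc, h.periodic.sub_eq] at h2
  have e1 : (u : ℂ) ≠ 0 := by exact_mod_cast hu1.ne'
  have e2 : (2 * π - u : ℂ) ≠ 0 := by exact_mod_cast hu2.ne'
  rw [chord, eq_div_of_mul_eq e1 ((mul_comm _ _).trans h1)]
  push_cast at h2 ⊢
  have h3 : meanVelocity c' s (u - 2 * π) = -(c (s + u) - c s) / (2 * π - u) := by
    rw [eq_div_iff e2]; linear_combination -h2
  rw [h3]
  ring

theorem chord_ne_zero (h : IsSimpleLoop c c') (s : ℝ) {u : ℝ} (hu : u ∈ Icc 0 (2 * π)) :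
    chord c' s u ≠ 0 := by
  rcases eq_or_lt_of_le hu.1 with rfl | h1
  · rw [h.chord_zero]; exact h.deriv_ne_zero s
  rcases eq_or_lt_of_le hu.2 with rfl | h2
  · rw [h.chord_two_pi]; exact neg_ne_zero.2 (h.deriv_ne_zero s)
  obtain ⟨r, hr, he⟩ := h.exists_chord_eq s ⟨h1, h2⟩
  rw [he]
  refine mul_ne_zero (by exact_mod_cast hr.ne') (sub_ne_zero.2 fun hc => ?_)
  obtain ⟨n, hn⟩ := h.injective _ _ hc
  have hn' : u = n * (2 * π) := by linarith
  have hπ := Real.pi_pos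
  have h3 : (0 : ℝ) < n := by
    by_contra! hc
    nlinarith
  have h4 : (n : ℝ) < 1 := by
    by_contra! hc
    nlinarith
  have h3' : 0 < n := by exact_mod_cast h3
  have h4' : n < 1 := by exact_mod_cast h4
  omega

theorem log_mul_I_sub {v : ℝ} (hv : 0 < v) : log (v * I) - log (v * -I) = π * I := by
  rw [log_ofReal_mul hv I_ne_zero, log_ofReal_mul hv (neg_ne_zero.2 I_ne_zero), log_I, log_neg_I]
  ring

/-- The Umlaufsatz for a loop with lowest point `c 0`, traversed there from left to right. -/
theorem hasWinding_deriv_of_lowest (h : IsSimpleLoop c c') (h0 : c 0 = 0)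
    (him : ∀ t, 0 ≤ (c t).im) {v : ℝ} (hv : 0 < v) (hc0 : c' 0 = v) : HasWinding c' 1 := by
  have hπ := Real.pi_pos
  -- Clamping `u` to `[0, 2π]` extends `chord` without zeros to the whole plane, which is simply
  -- connected, so that a single logarithm `Λ` serves all the paths below.
  set κ : ℝ → ℝ := fun u => max 0 (min u (2 * π))
  have hκ : ∀ u, κ u ∈ Icc 0 (2 * π) := fun u =>
    ⟨le_max_left _ _, max_le (by positivity) (min_le_right _ _)⟩
  have hκ' : ∀ u ∈ Icc 0 (2 * π), κ u = u := fun u hu => by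
    simp only [κ]; rw [min_eq_left hu.2, max_eq_right hu.1]
  have hEc : Continuous fun p : ℝ × ℝ => chord c' p.1 p.2 :=
    h.continuous_meanVelocity.sub (h.continuous_meanVelocity.comp
      (g := fun p : ℝ × ℝ => meanVelocity c' p.1 p.2) (f := fun p : ℝ × ℝ => (p.1, p.2 - 2 * π))
      (by fun_prop))
  have hκc : Continuous κ := by fun_prop
  obtain ⟨Λ, hΛ, hexp⟩ := exists_continuous_log (f := fun p : ℝ × ℝ => chord c' p.1 (κ p.2))
    (hEc.comp (f := fun p : ℝ × ℝ => (p.1, κ p.2)) (by fun_prop))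
    fun p => h.chord_ne_zero _ (hκ _)
  obtain ⟨k, hk⟩ := exists_hasWinding h.continuous_deriv h.periodic_deriv h.deriv_ne_zero
  have hz : (0 : ℝ) ∈ Icc 0 (2 * π) := left_mem_Icc.2 (by positivity)
  have hz' : 2 * π ∈ Icc 0 (2 * π) := right_mem_Icc.2 (by positivity)
  have e0 := hk.log_sub (L := fun s => Λ (s, 0)) (by fun_prop) fun s _ => by
    rw [hexp, hκ' _ hz, h.chord_zero]
  have hslit : ∀ z : ℂ, 0 ≤ z.re → z ≠ 0 → z ∈ slitPlane := fun z hz hz0 => by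
    rcases hz.lt_or_eq with h1 | h1
    · exact Or.inl h1
    · exact Or.inr fun h2 => hz0 (Complex.ext h1.symm h2)
  have hup : ∀ u ∈ Icc 0 (2 * π), 0 ≤ (chord c' 0 u).im := fun u hu => by
    rcases eq_or_lt_of_le hu.1 with rfl | h1
    · rw [h.chord_zero, hc0, ofReal_im]
    rcases eq_or_lt_of_le hu.2 with rfl | h2
    · rw [h.chord_two_pi, hc0, neg_im, ofReal_im, neg_zero]
    obtain ⟨r, hr, he⟩ := h.exists_chord_eq 0 ⟨h1, h2⟩
    rw [he, h0, sub_zero, im_ofReal_mul]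
    exact mul_nonneg hr.le (him _)
  have hdown : ∀ s ∈ Icc 0 (2 * π), (chord c' s (2 * π - s)).im ≤ 0 := fun s hs => by
    rcases eq_or_lt_of_le hs.1 with rfl | h1
    · rw [sub_zero, h.chord_two_pi, hc0, neg_im, ofReal_im, neg_zero]
    rcases eq_or_lt_of_le hs.2 with rfl | h2
    · have := h.periodic_deriv 0
      rw [zero_add] at this
      rw [sub_self, h.chord_zero, this, hc0, ofReal_im]
    obtain ⟨r, hr, he⟩ := h.exists_chord_eq s (u := 2 * π - s) ⟨by linarith, by linarith⟩
    have := h.periodic 0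
    rw [zero_add, h0] at this
    rw [he, add_sub_cancel, this, zero_sub, im_ofReal_mul, neg_im, mul_neg, neg_nonpos]
    exact mul_nonneg hr.le (him _)
  -- A quarter turn carries the closed upper, respectively lower, half-plane without `0` into the
  -- slit plane, where the principal logarithm is continuous.
  have hIne : ∀ z : ℂ, z ≠ 0 → exp (log (z * -I) + π / 2 * I) = z := fun z hz => by
    rw [exp_add, exp_log (mul_ne_zero hz (neg_ne_zero.2 I_ne_zero)), exp_pi_div_two_mul_I]
    linear_combination -z * I_sq
  have hIne' : ∀ z : ℂ, z ≠ 0 → exp (log (z * I) + -π / 2 * I) = z := fun z hz => by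
    rw [exp_add, exp_log (mul_ne_zero hz I_ne_zero), exp_neg_pi_div_two_mul_I]
    linear_combination -z * I_sq
  have e1 := log_sub_log_eq (isPreconnected_Icc (a := 0) (b := 2 * π))
    (L := fun u => Λ (0, u)) (L' := fun u => log (chord c' 0 u * -I) + π / 2 * I) (by fun_prop)
    ((ContinuousOn.clog (Continuous.continuousOn (by
      exact (hEc.comp (f := fun u : ℝ => ((0 : ℝ), u)) (by fun_prop)).mul continuous_const))
      fun u hu => hslit _ (by simpa using hup u hu)
        (mul_ne_zero (h.chord_ne_zero _ hu) (neg_ne_zero.2 I_ne_zero))).add continuousOn_const)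
    (fun u hu => by rw [hexp, hκ' _ hu, hIne _ (h.chord_ne_zero _ hu)]) hz hz'
  have hsub : ∀ s ∈ Icc 0 (2 * π), 2 * π - s ∈ Icc 0 (2 * π) := fun s hs =>
    ⟨by linarith [hs.2], by linarith [hs.1]⟩
  have e2 := log_sub_log_eq (isPreconnected_Icc (a := 0) (b := 2 * π))
    (L := fun s => Λ (s, 2 * π - s))
    (L' := fun s => log (chord c' s (2 * π - s) * I) + -π / 2 * I) (by fun_prop)
    ((ContinuousOn.clog (Continuous.continuousOn (by
      exact (hEc.comp (f := fun s : ℝ => (s, 2 * π - s)) (by fun_prop)).mul continuous_const))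
      fun s hs => hslit _ (by simpa using hdown s hs)
        (mul_ne_zero (h.chord_ne_zero _ (hsub s hs)) I_ne_zero)).add continuousOn_const)
    (fun s hs => by rw [hexp, hκ' _ (hsub s hs), hIne' _ (h.chord_ne_zero _ (hsub s hs))]) hz hz'
  have hper := h.periodic_deriv 0
  rw [zero_add] at hper
  simp only [sub_self, sub_zero, h.chord_zero, h.chord_two_pi, hper, hc0] at e0 e1 e2
  have e3 := log_mul_I_sub hv
  rw [neg_mul_neg] at e1
  rw [neg_mul, ← mul_neg] at e2
  -- Compare two ways from `(0, 0)` to `(2π, 0)`. Along `u = 0` the logarithm gains `2πik`. Through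
  -- `(0, 2π)` the chord turns from `v` to `-v` in the upper half-plane and back to `v` in the lower
  -- one, gaining `πi` each time.
  have : (k : ℂ) * (2 * π * I) = 1 * (2 * π * I) := by
    linear_combination -e0 + e1 + e2 + 2 * e3
  have hk1 : k = 1 := by exact_mod_cast mul_right_cancel₀ two_pi_I_ne_zero this
  exact hk1 ▸ hk

/-- Hopf's Umlaufsatz: a simple loop that does not wind `-1` times around any point has rotation
number one; moreover, it winds once around some point. -/
theorem hasWinding_deriv (h : IsSimpleLoop c c')
    (hpos : ∀ w, ¬ HasWinding (fun t => c t - w) (-1)) :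
    HasWinding c' 1 ∧ ∃ w, HasWinding (fun t => c t - w) 1 := by
  obtain ⟨t₀, ht₀⟩ : ∃ t₀, ∀ t, (c t₀).im ≤ (c t).im := by
    obtain ⟨t₀, -, hmin⟩ := (isCompact_Icc (a := 0) (b := 0 + 2 * π)).exists_isMinOn
      (nonempty_Icc.2 (by linarith [Real.pi_pos])) (continuous_im.comp h.continuous).continuousOn
    refine ⟨t₀, fun t => ?_⟩
    obtain ⟨s, hs, hst⟩ := h.periodic.exists_mem_Ico Real.two_pi_pos t 0
    rw [hst]
    exact hmin (Ico_subset_Icc_self hs)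
  have him : (c' t₀).im = 0 :=
    IsLocalMin.hasDerivAt_eq_zero (f := fun t => (c t).im) (.of_forall ht₀)
      (imCLM.hasFDerivAt.comp_hasDerivAt t₀ (h.hasDerivAt t₀))
  have hre : (c' t₀).re ≠ 0 := fun h0 => h.deriv_ne_zero t₀ (Complex.ext h0 him)
  have h1 := h.shift t₀ (c t₀)
  have hz : (fun t => c (t + t₀) - c t₀) 0 = 0 := by simp
  have hlow : ∀ t, 0 ≤ ((fun t => c (t + t₀) - c t₀) t).im := fun t => by simpa using ht₀ _
  have hback : ∀ (w : ℂ) (k : ℤ), HasWinding (fun t => c (t + t₀) - c t₀ - w) k →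
      HasWinding (fun t => c t - (c t₀ + w)) k := fun w k hw => by
    have := hw.comp_add (-t₀)
    convert this using 2 with t
    rw [neg_add_cancel_right]; ring
  -- If the lowest point is passed from right to left, the mirror image winds once around some
  -- point, so the curve itself winds `-1` times around a point, which `hpos` excludes.
  rcases hre.lt_or_gt with hneg | hpos'
  · obtain ⟨w, hw⟩ := h1.reflect.exists_hasWinding_one (by simp) (fun t => by
      simpa using ht₀ _) (by simpa using hneg)
    have h2 := hw.conj.const_mul (z := -1) (by simp)
    refine absurd (hback (-starRingEnd ℂ w) (-1) ?_) (hpos _)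
    convert h2 using 2 with t
    simp
    ring
  · obtain ⟨w, hw⟩ := h1.exists_hasWinding_one hz hlow (by simpa using hpos')
    refine ⟨?_, _, hback w 1 hw⟩
    have h2 := h1.hasWinding_deriv_of_lowest hz hlow hpos' (by
      rw [zero_add]; exact Complex.ext rfl (by simpa using him))
    simpa using h2.comp_add (-t₀)

end IsSimpleLoop


/-! ### The regions enclosed by regular closed curves -/

theorem unroll_periodic (c : Circle → Plane) : Function.Periodic (unroll c) (2 * π) := fun t => by
  simp [unroll]

theorem range_unroll (c : Circle → Plane) : range (unroll c) = range c :=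
  Circle.exp_surjective.range_comp c

namespace IsRegularClosedCurve

variable {c : Circle → Plane}

theorem hasDerivAt (h : IsRegularClosedCurve c) (t : ℝ) :
    HasDerivAt (unroll c) (deriv (unroll c) t) t :=
  (h.contDiff.differentiable one_ne_zero t).hasDerivAt

theorem hasDerivAt_toC (h : IsRegularClosedCurve c) (t : ℝ) :
    HasDerivAt (fun t => toC (unroll c t)) (toC (deriv (unroll c) t)) t :=
  toC.toContinuousLinearEquiv.hasFDerivAt.comp_hasDerivAt t (h.hasDerivAt t)

theorem continuous_unroll (h : IsRegularClosedCurve c) : Continuous (unroll c) :=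
  h.contDiff.continuous

theorem continuous_deriv (h : IsRegularClosedCurve c) : Continuous (deriv (unroll c)) :=
  h.contDiff.continuous_deriv le_rfl

theorem isPreconnected_range (h : IsRegularClosedCurve c) : IsPreconnected (range c) := by
  rw [← range_unroll]; exact _root_.isPreconnected_range h.continuous_unroll

theorem isCompact_range (h : IsRegularClosedCurve c) : IsCompact (range c) := by
  rw [← range_unroll]
  have := (isCompact_Icc (a := (0 : ℝ)) (b := 0 + 2 * π)).image h.continuous_unroll
  rwa [(unroll_periodic c).image_Icc Real.two_pi_pos] at this

theorem exists_hasWinding (h : IsRegularClosedCurve c) {p : Plane} (hp : p ∉ range c) :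
    ∃ k, HasWinding (fun t => toC (unroll c t) - toC p) k :=
  PlaneMap.exists_hasWinding ((toC.continuous.comp h.continuous_unroll).sub continuous_const)
    (fun t => by simp only [unroll_periodic c t]) fun t ht =>
      hp ⟨_, toC.injective (sub_eq_zero.1 ht)⟩

/-- Moving `p` by less than its distance to the curve changes the vectors to the curve by factors in
the disk of radius `1` about `1`. -/
theorem eventually_hasWinding (h : IsRegularClosedCurve c) {p : Plane} {k : ℤ}
    (hk : HasWinding (fun t => toC (unroll c t) - toC p) k) :
    ∀ᶠ q in 𝓝 p, HasWinding (fun t => toC (unroll c t) - toC q) k := by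
  have hp : p ∉ range c := by
    rintro hp
    rw [← range_unroll] at hp
    obtain ⟨t, rfl⟩ := hp
    exact hk.ne_zero t (sub_self _)
  obtain ⟨d, hd, hball⟩ := Metric.isOpen_iff.1 h.isCompact_range.isClosed.isOpen_compl p hp
  filter_upwards [Metric.ball_mem_nhds p hd] with q hq
  refine hk.of_div ((toC.continuous.comp h.continuous_unroll).sub continuous_const)
    (fun t => by simp only [unroll_periodic c t]) fun t => ?_
  have hne := hk.ne_zero t
  have h1 : (toC (unroll c t) - toC q) / (toC (unroll c t) - toC p) =
      1 + (toC p - toC q) / (toC (unroll c t) - toC p) := by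
    field_simp; ring
  rw [h1]
  refine mem_slitPlane_of_norm_lt_one ?_
  rw [norm_div, div_lt_one (norm_pos_iff.2 hne), ← map_sub, ← map_sub, toC.norm_map, toC.norm_map,
    ← dist_eq_norm, ← dist_eq_norm]
  have h2 : d ≤ dist (unroll c t) p := by
    by_contra! hlt
    exact hball (Metric.mem_ball.2 hlt) ⟨_, rfl⟩
  rw [dist_comm]
  exact (Metric.mem_ball.1 hq).trans_le h2

theorem exists_hasWinding_zero_of_norm_gt (h : IsRegularClosedCurve c) :
    ∃ R, ∀ p, R < ‖p‖ → HasWinding (fun t => toC (unroll c t) - toC p) 0 := by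
  obtain ⟨R, hR⟩ := h.isCompact_range.isBounded.exists_norm_le
  refine ⟨R, fun p hp => ?_⟩
  have hR0 : 0 ≤ R := (norm_nonneg _).trans (hR _ (mem_range_self 1))
  have hp0 : p ≠ 0 := norm_pos_iff.1 (hR0.trans_lt hp)
  have hp0' : toC p ≠ 0 := by simpa using hp0
  refine (HasWinding.const (neg_ne_zero.2 hp0')).of_div
    ((toC.continuous.comp h.continuous_unroll).sub continuous_const)
    (fun t => by simp only [unroll_periodic c t]) fun t => ?_
  have h1 : (toC (unroll c t) - toC p) / -toC p = 1 + -(toC (unroll c t) / toC p) := by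
    field_simp; ring
  rw [h1]
  refine mem_slitPlane_of_norm_lt_one ?_
  rw [norm_neg, norm_div, toC.norm_map, toC.norm_map, div_lt_one (norm_pos_iff.2 hp0)]
  exact (hR _ (mem_range_self _)).trans_lt hp

theorem hasWinding_of_mem_component (h : IsRegularClosedCurve c) {p q : Plane} {k : ℤ}
    (hk : HasWinding (fun t => toC (unroll c t) - toC p) k)
    (hq : q ∈ connectedComponentIn (range c)ᶜ p) :
    HasWinding (fun t => toC (unroll c t) - toC q) k := by
  set W : ℤ → Set Plane := fun l => {q | HasWinding (fun t => toC (unroll c t) - toC q) l}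
  have hW : ∀ l, IsOpen (W l) := fun l => isOpen_iff_mem_nhds.2 fun p hp =>
    h.eventually_hasWinding hp
  have hsub : connectedComponentIn (range c)ᶜ p ⊆ W k ∪ ⋃ l ≠ k, W l := fun x hx => by
    obtain ⟨l, hl⟩ := h.exists_hasWinding (connectedComponentIn_subset _ _ hx)
    rcases eq_or_ne l k with rfl | hlk
    · exact Or.inl hl
    · exact Or.inr (mem_biUnion hlk hl)
  refine isPreconnected_connectedComponentIn.subset_left_of_subset_union (hW k)
    (isOpen_biUnion fun l _ => hW l) ?_ hsub
    ⟨p, mem_connectedComponentIn (connectedComponentIn_nonempty_iff.1 ⟨q, hq⟩), hk⟩ hq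
  rw [disjoint_iUnion₂_right]
  exact fun l hl => disjoint_left.2 fun x hx hx' => hl (HasWinding.unique hx' hx)

/-- The winding number is constant on the component of `p`. That component is unbounded, so it
contains points too far away for the curve to wind around them. -/
theorem hasWinding_zero_of_notMem (h : IsRegularClosedCurve c) {p : Plane}
    (hp : p ∉ closedRegion c) : HasWinding (fun t => toC (unroll c t) - toC p) 0 := by
  have hpr : p ∉ range c := fun hr => hp (Or.inr hr)
  obtain ⟨k, hk⟩ := h.exists_hasWinding hpr
  obtain ⟨R, hR⟩ := h.exists_hasWinding_zero_of_norm_gt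
  obtain ⟨q, hq, hqR⟩ : ∃ q ∈ connectedComponentIn (range c)ᶜ p, R < ‖q‖ := by
    by_contra! hb
    exact hp (Or.inl ⟨hpr, isBounded_iff_forall_norm_le.2 ⟨R, hb⟩⟩)
  rwa [(h.hasWinding_of_mem_component hk hq).unique (hR q hqR)] at hk

theorem isOpen_inside (h : IsRegularClosedCurve c) : IsOpen (inside c) := by
  have hO := h.isCompact_range.isClosed.isOpen_compl
  refine isOpen_iff_mem_nhds.2 fun p hp => mem_of_superset
    (hO.connectedComponentIn.mem_nhds (mem_connectedComponentIn hp.1)) fun q hq => ?_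
  exact ⟨connectedComponentIn_subset _ _ hq, connectedComponentIn_eq hq ▸ hp.2⟩

theorem isClosed_closedRegion (h : IsRegularClosedCurve c) : IsClosed (closedRegion c) := by
  have hO := h.isCompact_range.isClosed.isOpen_compl
  refine isOpen_compl_iff.1 (isOpen_iff_mem_nhds.2 fun p hp => ?_)
  have hpr : p ∈ (range c)ᶜ := fun hr => hp (Or.inr hr)
  refine mem_of_superset (hO.connectedComponentIn.mem_nhds (mem_connectedComponentIn hpr))
    fun q hq hq' => ?_
  rcases hq' with hq' | hq'
  · exact hp (Or.inl ⟨hpr, connectedComponentIn_eq hq ▸ hq'.2⟩)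
  · exact connectedComponentIn_subset _ _ hq hq'

end IsRegularClosedCurve

namespace IsPositiveSimpleClosedCurve

variable {c : Circle → Plane}

theorem isSimpleLoop (h : IsPositiveSimpleClosedCurve c) :
    IsSimpleLoop (fun t => toC (unroll c t)) (fun t => toC (deriv (unroll c) t)) where
  hasDerivAt := h.regular.hasDerivAt_toC
  continuous_deriv := toC.continuous.comp h.regular.continuous_deriv
  periodic t := by simp only [unroll_periodic c t]
  deriv_ne_zero t := by simpa using h.regular.deriv_ne_zero t
  injective s t hst := Circle.exp_eq_exp.1 (h.injective (toC.injective hst))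

theorem hasWinding_one_of_mem_inside (h : IsPositiveSimpleClosedCurve c) {p : Plane}
    (hp : p ∈ inside c) : HasWinding (fun t => toC (unroll c t) - toC p) 1 := by
  obtain ⟨k, hk⟩ := h.regular.exists_hasWinding hp.1
  have h1 := hk.windingNumber_eq
  rw [h.positive p hp] at h1
  have : k = 1 := by exact_mod_cast h1.symm
  exact this ▸ hk

/-- A point of nonzero winding number must lie in `inside c`, where positivity forces the value `1`.
This rules out the value `-1`, as the Umlaufsatz requires, and places the point that it provides in
`inside c`. -/
theorem hasWinding_deriv (h : IsPositiveSimpleClosedCurve c) :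
    HasWinding (fun t => toC (deriv (unroll c) t)) 1 ∧ (inside c).Nonempty := by
  have key : ∀ w k, k ≠ 0 → HasWinding (fun t => toC (unroll c t) - w) k →
      toC.symm w ∈ inside c := fun w k hk hw => by
    by_contra hin
    have hr : toC.symm w ∉ range c := by
      rw [← range_unroll]
      rintro ⟨t, ht⟩
      exact hw.ne_zero t (by simp [ht])
    have h0 := h.regular.hasWinding_zero_of_notMem (p := toC.symm w) fun hc =>
      hc.elim hin hr
    rw [toC.apply_symm_apply] at h0
    exact hk (hw.unique h0)
  obtain ⟨h1, w, hw⟩ := h.isSimpleLoop.hasWinding_deriv fun w hw => by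
    have h1 := h.hasWinding_one_of_mem_inside (key w (-1) (by norm_num) hw)
    rw [toC.apply_symm_apply] at h1
    exact absurd (hw.unique h1) (by norm_num)
  exact ⟨h1, _, key w 1 one_ne_zero hw⟩

/-- A union of bounded components could be unbounded; here far points have winding number `0` and
points of `inside c` have `1`. -/
theorem isCompact_closedRegion (h : IsPositiveSimpleClosedCurve c) :
    IsCompact (closedRegion c) := by
  refine Metric.isCompact_of_isClosed_isBounded h.regular.isClosed_closedRegion
    (Bornology.IsBounded.union ?_ h.regular.isCompact_range.isBounded)
  obtain ⟨R, hR⟩ := h.regular.exists_hasWinding_zero_of_norm_gt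
  refine isBounded_iff_forall_norm_le.2 ⟨R, fun p hp => ?_⟩
  by_contra! hlt
  exact absurd ((hR p hlt).unique (h.hasWinding_one_of_mem_inside hp)) (by norm_num)

end IsPositiveSimpleClosedCurve

/-! ### Disks with holes -/

namespace IsDiskWithHoles

variable {Δ : Set Plane} {γ₀ : Circle → Plane} {n : ℕ} {γ : Fin n → Circle → Plane}

theorem isCompact (h : IsDiskWithHoles Δ γ₀ γ) : IsCompact Δ := by
  rw [h.eq_diff]
  exact h.outer.isCompact_closedRegion.diff
    (isOpen_iUnion fun i => (h.inner i).regular.isOpen_inside)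

theorem range_outer_subset (h : IsDiskWithHoles Δ γ₀ γ) : range γ₀ ⊆ Δ := fun p hp => by
  rw [h.eq_diff]
  refine ⟨Or.inr hp, fun hi => ?_⟩
  obtain ⟨i, hi⟩ := mem_iUnion.1 hi
  exact (h.subset i (Or.inl hi)).1 hp

theorem range_inner_subset (h : IsDiskWithHoles Δ γ₀ γ) (i : Fin n) : range (γ i) ⊆ Δ :=
  fun p hp => by
  rw [h.eq_diff]
  refine ⟨Or.inl (h.subset i (Or.inr hp)), fun hj => ?_⟩
  obtain ⟨j, hj⟩ := mem_iUnion.1 hj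
  rcases eq_or_ne i j with rfl | hij
  · exact hj.1 hp
  · exact disjoint_left.1 (h.disjoint i j hij) (Or.inr hp) (Or.inl hj)

theorem notMem_of_mem_inside (h : IsDiskWithHoles Δ γ₀ γ) {i : Fin n} {p : Plane}
    (hp : p ∈ inside (γ i)) : p ∉ Δ := fun hΔ => by
  rw [h.eq_diff] at hΔ
  exact hΔ.2 (mem_iUnion.2 ⟨i, hp⟩)

theorem hasWinding_inner (h : IsDiskWithHoles Δ γ₀ γ) {i : Fin n} {p : Plane}
    (hp : p ∈ inside (γ i)) (j : Fin n) :
    HasWinding (fun t => toC (unroll (γ j) t) - toC p) (if j = i then 1 else 0) := by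
  split_ifs with hij
  · exact (h.inner j).hasWinding_one_of_mem_inside (hij ▸ hp)
  · exact (h.inner j).regular.hasWinding_zero_of_notMem fun hj =>
      disjoint_left.1 (h.disjoint j i hij) hj (Or.inl hp)

/-- Outside the disk with holes, the winding number of the outer curve is the sum of the winding
numbers of the inner curves. -/
theorem winding_eq_sum (h : IsDiskWithHoles Δ γ₀ γ) {p : Plane} (hp : p ∉ Δ) {k₀ : ℤ}
    {k : Fin n → ℤ} (hk₀ : HasWinding (fun t => toC (unroll γ₀ t) - toC p) k₀)
    (hk : ∀ i, HasWinding (fun t => toC (unroll (γ i) t) - toC p) (k i)) : k₀ = ∑ i, k i := by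
  by_cases hout : p ∈ closedRegion γ₀
  · obtain ⟨i, hi⟩ : ∃ i, p ∈ inside (γ i) := by
      by_contra hno
      rw [h.eq_diff] at hp
      exact hp ⟨hout, fun hU => hno (mem_iUnion.1 hU)⟩
    have h0 := h.outer.hasWinding_one_of_mem_inside (h.subset i (Or.inl hi))
    have h1 : ∀ j, k j = if j = i then 1 else 0 := fun j =>
      (hk j).unique (h.hasWinding_inner hi j)
    simp [h1, hk₀.unique h0]
  · have h1 : ∀ j, k j = 0 := fun j => (hk j).unique
      ((h.inner j).regular.hasWinding_zero_of_notMem fun hj => hout (Or.inl (h.subset j hj)))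
    simp [h1, hk₀.unique (h.outer.regular.hasWinding_zero_of_notMem hout)]

/-- The winding number of a map without zeros near a disk with holes, along the outer curve, is
the sum of its winding numbers along the inner curves. -/
theorem winding_comp_eq_sum (h : IsDiskWithHoles Δ γ₀ γ) {U : Set ℂ} (hU : IsOpen U)
    (hΔU : ∀ p ∈ Δ, toC p ∈ U) {f : ℂ → ℂ} (hf : ContDiffOn ℝ 2 f U) (h0 : ∀ z ∈ U, f z ≠ 0)
    {k₀ : ℤ} {k : Fin n → ℤ} (hk₀ : HasWinding (fun t => f (toC (unroll γ₀ t))) k₀)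
    (hk : ∀ i, HasWinding (fun t => f (toC (unroll (γ i) t))) (k i)) : k₀ = ∑ i, k i := by
  -- The cycle is `γ₀ - ∑ γᵢ`: `none` is the outer curve with weight `1`, each `some i` an inner
  -- curve with weight `-1`.
  set C : Option (Fin n) → Circle → Plane := fun o => o.elim γ₀ γ with hCdef
  have hC : ∀ o, IsRegularClosedCurve (C o) := fun o => by
    cases o
    exacts [h.outer.regular, (h.inner _).regular]
  have hCΔ : ∀ o, range (C o) ⊆ Δ := fun o => by
    cases o
    exacts [h.range_outer_subset, h.range_inner_subset _]
  have := sum_winding_comp_eq_zero (ι := Option (Fin n)) (K := toC '' Δ) (U := U) (f := f)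
    (c := fun o t => toC (unroll (C o) t)) (c' := fun o t => toC (deriv (unroll (C o)) t))
    (h.isCompact.image toC.continuous) hU (by rintro _ ⟨p, hp, rfl⟩; exact hΔU p hp) hf h0
    (fun o => (hC o).hasDerivAt_toC) (fun o => toC.continuous.comp (hC o).continuous_deriv)
    (fun o t => by simp only [unroll_periodic (C o) t])
    (fun o t => mem_image_of_mem _ (hCΔ o ⟨_, rfl⟩)) (fun o => o.elim 1 fun _ => -1)
    (fun w hw l hl => by
      have hw' : toC.symm w ∉ Δ := fun hΔ => hw ⟨_, hΔ, toC.apply_symm_apply w⟩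
      have := h.winding_eq_sum hw' (k₀ := l none) (k := fun i => l (some i))
        (by simpa [hCdef] using hl none) (fun i => by simpa [hCdef] using hl (some i))
      simp [Fintype.sum_option, this])
    (k := fun o => o.elim k₀ k) (fun o => by
      cases o
      exacts [hk₀, hk _])
  simp only [Fintype.sum_option, Option.elim_none, Option.elim_some, one_mul, neg_mul,
    Finset.sum_neg_distrib] at this
  omega

-- No inner curve can be separated from the outer one, since a locally defined function would then
-- violate `winding_comp_eq_sum`. Once all boundary curves lie in `U`, the part of `Δ` in `V` is
-- both open and closed in the plane.
open Classical in
theorem subset_of_range_outer_subset (h : IsDiskWithHoles Δ γ₀ γ) {U V : Set Plane}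
    (hU : IsOpen U) (hV : IsOpen V) (hUV : Disjoint U V) (hΔ : Δ ⊆ U ∪ V) (h₀ : range γ₀ ⊆ U) :
    Δ ⊆ U := by
  have hone : ∀ i, range (γ i) ⊆ U ∨ range (γ i) ⊆ V := fun i =>
    (h.inner i).regular.isPreconnected_range.subset_or_subset hU hV hUV
      ((h.range_inner_subset i).trans hΔ)
  have hin : ∀ i, range (γ i) ⊆ U := by
    intro i
    by_contra hi
    obtain ⟨w, hw⟩ := (h.inner i).hasWinding_deriv.2
    -- If `γ i` lies in `V`, this function winds once along `γ i` and along no other boundary curve,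
    -- which gives `0 = 1`. Its only zero can be at `w`, which lies in the hole and is removed from
    -- `V`.
    set f : ℂ → ℂ := fun z => if toC.symm z ∈ V then z - toC w else 1
    set V' : Set Plane := V \ {w}
    have hV' : IsOpen V' := hV.sdiff isClosed_singleton
    have hfV : ∀ q ∈ V, f (toC q) = toC q - toC w := fun q hq => by
      simp only [f]; rw [if_pos (by simpa using hq)]
    have hfU : ∀ q ∈ U, f (toC q) = 1 := fun q hq => by
      simp only [f]; rw [if_neg (by simpa using disjoint_left.1 hUV hq)]
    have hfd : ContDiffOn ℝ 2 f (toC.symm ⁻¹' (U ∪ V')) := fun z hz => by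
      refine ContDiffAt.contDiffWithinAt ?_
      rcases hz with hz | hz
      · refine (contDiffAt_const (c := (1 : ℂ))).congr_of_eventuallyEq ?_
        filter_upwards [(hU.preimage toC.symm.continuous).mem_nhds hz] with y hy
        simpa using hfU _ hy
      · refine (contDiffAt_id.sub (contDiffAt_const (c := toC w))).congr_of_eventuallyEq ?_
        filter_upwards [(hV.preimage toC.symm.continuous).mem_nhds hz.1] with y hy
        simpa using hfV _ hy
    have hf0 : ∀ z ∈ toC.symm ⁻¹' (U ∪ V'), f z ≠ 0 := fun z hz => by
      obtain ⟨q, rfl⟩ := toC.surjective z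
      simp only [mem_preimage, toC.symm_apply_apply] at hz
      rcases hz with hz | hz
      · rw [hfU q hz]; exact one_ne_zero
      · rw [hfV q hz.1]; exact sub_ne_zero.2 fun he => hz.2 (toC.injective he)
    have hΔ' : ∀ p ∈ Δ, toC p ∈ toC.symm ⁻¹' (U ∪ V') := fun p hp => by
      simp only [mem_preimage, toC.symm_apply_apply]
      exact (hΔ hp).imp id fun hpV =>
        ⟨hpV, fun he => h.notMem_of_mem_inside hw (mem_singleton_iff.1 he ▸ hp)⟩
    have := h.winding_comp_eq_sum ((hU.union hV').preimage toC.symm.continuous) hΔ' hfd hf0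
      (k₀ := 0) (k := fun j => if j = i then 1 else 0)
      (by
        have : (fun t => f (toC (unroll γ₀ t))) = fun _ => 1 :=
          funext fun t => hfU _ (h₀ ⟨_, rfl⟩)
        rw [this]; exact HasWinding.const one_ne_zero)
      (fun j => by
        rcases hone j with hj | hj
        · have : (fun t => f (toC (unroll (γ j) t))) = fun _ => 1 :=
            funext fun t => hfU _ (hj ⟨_, rfl⟩)
          rw [this, if_neg (fun hji : j = i => hi (hji ▸ hj))]; exact HasWinding.const one_ne_zero
        · have : (fun t => f (toC (unroll (γ j) t))) = fun t => toC (unroll (γ j) t) - toC w :=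
            funext fun t => hfV _ (hj ⟨_, rfl⟩)
          rw [this]; exact h.hasWinding_inner hw j)
    simp at this
  have hopen : Δ ∩ V = (inside γ₀ ∩ ⋂ i, (closedRegion (γ i))ᶜ) ∩ V := by
    ext p
    refine and_congr_left fun hpV => ?_
    have hpU : p ∉ U := fun hpU => disjoint_left.1 hUV hpU hpV
    simp only [h.eq_diff, Set.mem_sdiff, closedRegion, mem_union, mem_iUnion, mem_inter_iff, mem_iInter,
      mem_compl_iff, not_or, not_exists]
    constructor
    · rintro ⟨h1, h2⟩
      exact ⟨h1.resolve_right fun hr => hpU (h₀ hr), fun i => ⟨h2 i, fun hr => hpU (hin i hr)⟩⟩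
    · rintro ⟨h1, h2⟩
      exact ⟨Or.inl h1, fun i => (h2 i).1⟩
  have hclosed : Δ ∩ V = Δ ∩ Uᶜ := by
    ext p
    exact and_congr_right fun hp =>
      ⟨fun hpV hpU => disjoint_left.1 hUV hpU hpV, fun hpU => (hΔ hp).resolve_left hpU⟩
  have hclopen : IsClopen (Δ ∩ V) := by
    constructor
    · rw [hclosed]; exact h.isCompact.isClosed.inter hU.isClosed_compl
    · rw [hopen]
      exact (h.outer.regular.isOpen_inside.inter (isOpen_iInter_of_finite fun i =>
        (h.inner i).regular.isClosed_closedRegion.isOpen_compl)).inter hV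
  intro p hp
  refine (hΔ hp).resolve_right fun hpV => ?_
  rcases isClopen_iff.1 hclopen with he | he
  · exact (he ▸ (⟨hp, hpV⟩ : p ∈ Δ ∩ V) : p ∈ (∅ : Set Plane))
  · have : γ₀ 1 ∈ Δ ∩ V := he ▸ mem_univ _
    exact disjoint_left.1 hUV (h₀ (mem_range_self 1)) this.2

/-- A disk with holes is connected. -/
theorem subset_or_subset (h : IsDiskWithHoles Δ γ₀ γ) {U V : Set Plane} (hU : IsOpen U)
    (hV : IsOpen V) (hUV : Disjoint U V) (hΔ : Δ ⊆ U ∪ V) : Δ ⊆ U ∨ Δ ⊆ V :=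
  (h.outer.regular.isPreconnected_range.subset_or_subset hU hV hUV
    (h.range_outer_subset.trans hΔ)).imp (h.subset_of_range_outer_subset hU hV hUV hΔ)
    (h.subset_of_range_outer_subset hV hU hUV.symm (by rwa [union_comm]))

end IsDiskWithHoles



/-! ### Rotation numbers of image curves -/

theorem toC_map (A : Plane →L[ℝ] Plane) (v : Plane) :
    toC (A v) = v 0 * toC (A !₂[1, 0]) + v 1 * toC (A !₂[0, 1]) := by
  have hv : v = v 0 • !₂[(1 : ℝ), 0] + v 1 • !₂[(0 : ℝ), 1] := by
    ext i; fin_cases i <;> simp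
  conv_lhs => rw [hv]
  simp only [map_add, map_smul, real_smul]

theorem det_eq (A : Plane →L[ℝ] Plane) :
    A.det = (starRingEnd ℂ (toC (A !₂[1, 0])) * toC (A !₂[0, 1])).im := by
  have h1 : EuclideanSpace.single (0 : Fin 2) (1 : ℝ) = !₂[1, 0] := by
    ext i; fin_cases i <;> simp
  have h2 : EuclideanSpace.single (1 : Fin 2) (1 : ℝ) = !₂[0, 1] := by
    ext i; fin_cases i <;> simp
  rw [ContinuousLinearMap.det, ← LinearMap.det_toMatrix (EuclideanSpace.basisFun (Fin 2) ℝ).toBasis,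
    Matrix.det_fin_two]
  simp [LinearMap.toMatrix_apply, h1, h2]
  ring

/-- If the quotient were a real `r ≤ 0` with `y ≠ 0`, imaginary parts would give `im τ = r s`, hence
`s * im τ = r s² ≤ 0`. If `y = 0`, the quotient is `1`. -/
theorem div_mem_slitPlane {τ : ℂ} {s x y : ℝ} (hs : 0 < s * τ.im) (hxy : x ≠ 0 ∨ y ≠ 0) :
    (x + y * τ) / (x + (s * y : ℝ) * I) ∈ slitPlane := by
  have hs0 : s ≠ 0 := fun h => by simp [h] at hs
  have hne : (x + (s * y : ℝ) * I : ℂ) ≠ 0 := fun h => by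
    have hre := congrArg Complex.re h
    have him := congrArg Complex.im h
    simp [hs0] at hre him
    exact hxy.elim (· hre) (· him)
  by_contra hq
  simp only [slitPlane, Set.mem_ofPred_eq, not_or, not_lt, not_not] at hq
  set r := ((x + y * τ) / (x + (s * y : ℝ) * I)).re
  have hr : (x + y * τ) / (x + (s * y : ℝ) * I) = (r : ℂ) := Complex.ext rfl (by simpa using hq.2)
  rw [div_eq_iff hne] at hr
  have hre := congrArg Complex.re hr
  have him := congrArg Complex.im hr
  simp at hre him
  rcases eq_or_ne y 0 with rfl | hy
  · have hx : x ≠ 0 := hxy.resolve_right (by simp)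
    have : x * (1 - r) = 0 := by linarith
    rcases mul_eq_zero.1 this with h | h
    · exact hx h
    · linarith [hq.1]
  · have : τ.im = r * s := mul_left_cancel₀ hy (by linarith)
    rw [this] at hs
    nlinarith [hq.1, mul_self_nonneg s]

theorem map_ne_zero_of_det_ne_zero {A : Plane →L[ℝ] Plane} (hA : A.det ≠ 0) {v : Plane}
    (hv : v ≠ 0) : A v ≠ 0 := fun h => by
  have h1 : IsUnit (LinearMap.det (A : Plane →ₗ[ℝ] Plane)) := isUnit_iff_ne_zero.2 hA
  exact hv ((LinearMap.equivOfIsUnitDet h1).injective (a₁ := v) (a₂ := 0) (by simpa using h))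

theorem map_div_mem_slitPlane {A : Plane →L[ℝ] Plane} {s : ℝ} (hs : 0 < s * A.det) {v : Plane}
    (hv : v ≠ 0) : toC (A v) / (toC (A !₂[1, 0]) * (v 0 + (s * v 1 : ℝ) * I)) ∈ slitPlane := by
  have hdet : A.det ≠ 0 := fun h => by simp [h] at hs
  have ha : toC (A !₂[1, 0]) ≠ 0 := by
    have := map_ne_zero_of_det_ne_zero hdet (v := !₂[1, 0]) fun h => by
      simpa using congrArg (fun v : Plane => v 0) h
    simpa using this
  set a := toC (A !₂[1, 0])
  set b := toC (A !₂[0, 1])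
  have hτ : 0 < s * (b / a).im := by
    have : (b / a).im = A.det / normSq a := by
      rw [det_eq, div_eq_mul_inv, inv_def, ← mul_assoc, im_mul_ofReal, mul_comm b]
      rfl
    rw [this, ← mul_div_assoc]
    exact div_pos hs (normSq_pos.2 ha)
  have hxy : v 0 ≠ 0 ∨ v 1 ≠ 0 := by
    by_contra! h
    exact hv (by ext i; fin_cases i <;> simp [h.1, h.2])
  have := div_mem_slitPlane hτ hxy
  rwa [← mul_div_mul_left _ _ ha, mul_add, mul_left_comm, mul_div_cancel₀ _ ha, mul_comm a,
    ← toC_map] at this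

section Image

variable {F : Plane → Plane} {c : Circle → Plane}

theorem hasDerivAt_unroll_comp (hF : Differentiable ℝ F) (hc : IsRegularClosedCurve c) (t : ℝ) :
    HasDerivAt (unroll (F ∘ c)) (fderiv ℝ F (unroll c t) (deriv (unroll c) t)) t :=
  (hF (unroll c t)).hasFDerivAt.comp_hasDerivAt t (hc.hasDerivAt t)

theorem IsRegularClosedCurve.comp (hF : ContDiff ℝ 1 F) (hc : IsRegularClosedCurve c)
    (hj : ∀ p ∈ range c, jac F p ≠ 0) : IsRegularClosedCurve (F ∘ c) where
  contDiff := hF.comp hc.contDiff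
  deriv_ne_zero t := by
    rw [(hasDerivAt_unroll_comp (hF.differentiable one_ne_zero) hc t).deriv]
    exact map_ne_zero_of_det_ne_zero (hj _ ⟨_, rfl⟩) (hc.deriv_ne_zero t)

theorem exists_hasWinding_fderiv (hF : ContDiff ℝ 1 F) (hc : IsRegularClosedCurve c)
    (hj : ∀ p ∈ range c, jac F p ≠ 0) :
    ∃ k, HasWinding (fun t => toC (fderiv ℝ F (unroll c t) !₂[1, 0])) k := by
  have := hF.continuous_fderiv one_ne_zero
  have := hc.continuous_unroll
  refine exists_hasWinding (by fun_prop) (fun t => by simp only [unroll_periodic c t])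
    fun t ht => ?_
  refine map_ne_zero_of_det_ne_zero (hj _ ⟨_, rfl⟩) (v := !₂[1, 0]) (fun h => ?_)
    (toC.map_eq_zero_iff.1 ht)
  simpa using congrArg (fun v : Plane => v 0) h

/-- By `map_div_mem_slitPlane` the image velocity winds like `DF·e₁` times the velocity of `c` when
`s = 1`, and times its conjugate when `s = -1`. The Umlaufsatz makes that factor contribute `s`. -/
theorem rotationNumber_comp (hF : ContDiff ℝ 1 F) (hc : IsPositiveSimpleClosedCurve c) {s : ℝ}
    (hs : s = 1 ∨ s = -1) (hj : ∀ p ∈ range c, 0 < s * jac F p) {k : ℤ}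
    (hk : HasWinding (fun t => toC (fderiv ℝ F (unroll c t) !₂[1, 0])) k) :
    rotationNumber (F ∘ c) = k + s := by
  have hr := hc.regular
  have hd : deriv (unroll (F ∘ c)) = fun t => fderiv ℝ F (unroll c t) (deriv (unroll c) t) :=
    funext fun t => (hasDerivAt_unroll_comp (hF.differentiable one_ne_zero) hr t).deriv
  have hv := hc.hasWinding_deriv.1
  have h1 := hF.continuous_fderiv one_ne_zero
  have h2 := hr.continuous_unroll
  have h3 := hr.continuous_deriv
  have hcont : Continuous fun t => toC (fderiv ℝ F (unroll c t) (deriv (unroll c) t)) := by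
    fun_prop
  have hper : Function.Periodic
      (fun t => toC (fderiv ℝ F (unroll c t) (deriv (unroll c) t))) (2 * π) := fun t => by
    have : deriv (unroll c) (t + 2 * π) = deriv (unroll c) t :=
      toC.injective (hc.isSimpleLoop.periodic_deriv t)
    simp only [unroll_periodic c t, this]
  have hslit := fun t => map_div_mem_slitPlane (hj (unroll c t) ⟨_, rfl⟩) (hr.deriv_ne_zero t)
  rcases hs with rfl | rfl
  · have hw : HasWinding (fun t => toC (fderiv ℝ F (unroll c t) (deriv (unroll c) t))) (k + 1) :=
      (hk.mul hv).of_div hcont hper fun t => by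
        have := hslit t
        rwa [one_mul, ← toC_apply] at this
    rw [rotationNumber, hd, HasWinding.windingNumber_eq (k := k + 1) (by simpa using hw)]
    push_cast; ring
  · have hw : HasWinding (fun t => toC (fderiv ℝ F (unroll c t) (deriv (unroll c) t))) (k + -1) :=
      (hk.mul hv.conj).of_div hcont hper fun t => by
        have := hslit t
        rwa [show (deriv (unroll c) t 0 + (-1 * deriv (unroll c) t 1 : ℝ) * I : ℂ) =
          starRingEnd ℂ (toC (deriv (unroll c) t)) by rw [toC_apply]; simp] at this
    rw [rotationNumber, hd, HasWinding.windingNumber_eq (k := k + -1) (by simpa using hw)]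
    push_cast; ring

end Image

theorem IsDiskWithHoles.exists_sign {Δ : Set Plane} {γ₀ : Circle → Plane} {n : ℕ}
    {γ : Fin n → Circle → Plane} (h : IsDiskWithHoles Δ γ₀ γ) {g : Plane → ℝ} (hg : Continuous g)
    (h0 : ∀ p ∈ Δ, g p ≠ 0) : ∃ s : ℝ, (s = 1 ∨ s = -1) ∧ ∀ p ∈ Δ, 0 < s * g p := by
  rcases h.subset_or_subset (U := {p | 0 < g p}) (V := {p | g p < 0})
    (isOpen_lt continuous_const hg) (isOpen_lt hg continuous_const)
    (disjoint_left.2 fun p (hp : 0 < g p) hp' => lt_asymm hp hp')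
    (fun p hp => (h0 p hp).lt_or_gt.symm) with h1 | h1
  · exact ⟨1, Or.inl rfl, fun p hp => by simpa using h1 hp⟩
  · exact ⟨-1, Or.inr rfl, fun p hp => by simpa using h1 hp⟩

end PlaneMap

theorem mainTheorem2 (F : PlaneMap.Plane → PlaneMap.Plane) (hF : PlaneMap.IsExcellent F)
    (n : ℕ) (γ₀ : Circle → PlaneMap.Plane) (γ : Fin n → Circle → PlaneMap.Plane)
    (Δ : Set PlaneMap.Plane) (hΔ : PlaneMap.IsDiskWithHoles Δ γ₀ γ)
    (hC : Δ ∩ PlaneMap.criticalSet F = ∅) :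
    PlaneMap.IsRegularClosedCurve (F ∘ γ₀) ∧
      (∀ i, PlaneMap.IsRegularClosedCurve (F ∘ γ i)) ∧
      ∃ s : ℝ, (∀ p ∈ Δ, Real.sign (PlaneMap.jac F p) = s) ∧
        PlaneMap.rotationNumber (F ∘ γ₀) =
          ∑ i, PlaneMap.rotationNumber (F ∘ γ i) - s * ((n : ℝ) - 1) := by
  open PlaneMap in
  have hF1 : ContDiff ℝ 1 F := hF.smooth.of_le (by exact_mod_cast le_top)
  have hj : ∀ p ∈ Δ, jac F p ≠ 0 := fun p hp h0 => by
    have : p ∈ Δ ∩ criticalSet F := ⟨hp, h0⟩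
    rw [hC] at this
    exact this
  have hj₀ : ∀ p ∈ Set.range γ₀, jac F p ≠ 0 := fun p hp => hj p (hΔ.range_outer_subset hp)
  have hjγ : ∀ i, ∀ p ∈ Set.range (γ i), jac F p ≠ 0 := fun i p hp =>
    hj p (hΔ.range_inner_subset i hp)
  have hjc : Continuous (jac F) :=
    ContinuousLinearMap.continuous_det.comp (hF1.continuous_fderiv one_ne_zero)
  refine ⟨hΔ.outer.regular.comp hF1 hj₀, fun i => (hΔ.inner i).regular.comp hF1 (hjγ i), ?_⟩
  obtain ⟨s, hs, hpos⟩ := hΔ.exists_sign hjc hj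
  refine ⟨s, fun p hp => ?_, ?_⟩
  · have := hpos p hp
    rcases hs with rfl | rfl
    · exact Real.sign_of_pos (by linarith)
    · exact Real.sign_of_neg (by linarith)
  obtain ⟨k₀, hk₀⟩ := exists_hasWinding_fderiv hF1 hΔ.outer.regular hj₀
  choose k hk using fun i => exists_hasWinding_fderiv hF1 (hΔ.inner i).regular (hjγ i)
  -- The function whose winding numbers are compared is `DF·e₁`, which vanishes nowhere on `Δ`; two
  -- derivatives of it are needed for its argument form to be `C¹`.
  have hf : ContDiff ℝ 2 fun z : ℂ => toC (fderiv ℝ F (toC.symm z) !₂[1, 0]) := by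
    have h1 : ContDiff ℝ 2 (fderiv ℝ F) :=
      (contDiff_infty.1 hF.smooth 3).fderiv_right (m := 2) (by norm_num)
    exact toC.contDiff.comp ((h1.comp toC.symm.contDiff).clm_apply contDiff_const)
  have hsum : k₀ = ∑ i, k i := hΔ.winding_comp_eq_sum
    (U := {z | toC (fderiv ℝ F (toC.symm z) !₂[1, 0]) ≠ 0})
    (isOpen_ne_fun hf.continuous continuous_const)
    (fun p hp h0 => by
      rw [toC.symm_apply_apply] at h0
      refine map_ne_zero_of_det_ne_zero (hj p hp) (v := !₂[1, 0]) (fun h => ?_)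
        (toC.map_eq_zero_iff.1 h0)
      simpa using congrArg (fun v : Plane => v 0) h)
    hf.contDiffOn (fun z hz => hz) (by simpa using hk₀) (fun i => by simpa using hk i)
  rw [rotationNumber_comp hF1 hΔ.outer hs
    (fun p hp => hpos p (hΔ.range_outer_subset hp)) hk₀]
  have hi : ∀ i, rotationNumber (F ∘ γ i) = k i + s := fun i =>
    rotationNumber_comp hF1 (hΔ.inner i) hs
      (fun p hp => hpos p (hΔ.range_inner_subset i hp)) (hk i)
  simp only [hi, Finset.sum_add_distrib, Finset.sum_const, Finset.card_univ, Fintype.card_fin,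
    nsmul_eq_mul, hsum]
  push_cast
  ring
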